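/- Let $(X_n)_{n\in\mathbb Z}$ be a stationary and ergodic Markov chain on a probability space $(\Omega,P)$ with values in a measurable space $\mathcal X$, let $\pi$ be the distribution of $X_0$, and let $Q$ be a regular conditional distribution of $X_1$ given $X_0$. For $x\in\mathcal X$ let $P^x$ denote the law of the chain with transition kernel $Q$ started at $X_0=x$. Let $g:\mathcal X\to\mathbb R$ be measurable with $\int g\,d\pi=0$ and $\int g^2\,d\pi<\infty$, and put $S_n=\sum_{i=1}^n g(X_i)$ and $\sigma_n^2=E(S_n^2)$. Assume that $\sigma_n^2\to\infty$ as $n\to\infty$. Suppose that, for some real $q\ge 2$, $$\|E(S_n\mid X_0)\|_{L^2(P)}=o\big(\sqrt n\,(\log n)^{-q}\big)\qquad(n\to\infty),$$ and that $\sigma^2:=\lim_{n\to\infty}\sigma_n^2/n$ exists and equals $0$. Then $$\frac{\max_{k\le n}|S_k|}{\sqrt n}\longrightarrow 0\quad\text{in } P\text{-probability}.$$ If moreover $q>5/2$, then for $\pi$-a.e. $x$ and every $\varepsilon>0$, $$\lim_{n\to\infty}P^x\Big[\max_{k\le n}|S_k|\ge\varepsilon\sqrt n\Big]=0.$$ 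-/

import Mathlib

open MeasureTheory ProbabilityTheory Filter
open scoped Topology ENNReal

noncomputable section

namespace StationarySums

variable {Ω 𝓧 : Type*} [MeasurableSpace Ω] [MeasurableSpace 𝓧]

/-- The past `σ(…, X_{j-1}, X_j)` of the process `X` up to time `j`. -/
abbrev past (X : ℤ → Ω → 𝓧) (j : ℤ) : MeasurableSpace Ω :=
  ⨆ k : ℤ, ⨆ _ : k ≤ j, MeasurableSpace.comap (X k) inferInstance

/-- The left shift on two-sided sequences. -/
def shift (x : ℤ → 𝓧) : ℤ → 𝓧 := fun k => x (k + 1)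

/-- `(X_n)_{n ∈ ℤ}` is, under `P`, a stationary and ergodic Markov chain, and `Q` is a regular
conditional distribution of `X_1` given `X_0`. The predicate `Ergodic` of the law of the process
includes that the shift preserves this law (stationarity). -/
structure IsStationaryErgodicMarkovChain (P : Measure Ω) (X : ℤ → Ω → 𝓧) (Q : Kernel 𝓧 𝓧) :
    Prop where
  measurable : ∀ k, Measurable (X k)
  ergodic : Ergodic (shift (𝓧 := 𝓧)) (P.map (fun ω k => X k ω))
  markov : ∀ (j : ℤ) (B : Set 𝓧), MeasurableSet B →
    P[(X (j + 1) ⁻¹' B).indicator (fun _ => (1 : ℝ)) | past X j]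
      =ᵐ[P] fun ω => (Q (X j ω)).real B

/-- `S_n = g(x_1) + ⋯ + g(x_n)` along a path `x_0, x_1, …`. -/
def partialSum (g : 𝓧 → ℝ) (n : ℕ) (x : ℕ → 𝓧) : ℝ :=
  ∑ i ∈ Finset.Icc 1 n, g (x i)

/-- `max_{k ≤ n} |S_k|` along a path; the index `k = 0`, for which `S_0 = 0`, is included so that
the maximum is taken over a nonempty set also for `n = 0`. -/
def maxAbsPartialSum (g : 𝓧 → ℝ) (n : ℕ) (x : ℕ → 𝓧) : ℝ :=
  (Finset.range (n + 1)).sup' Finset.nonempty_range_add_one (fun k => |partialSum g k x|)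

/-- The forward path `X_0, X_1, …` of a two-sided process. -/
def forward (X : ℤ → Ω → 𝓧) (ω : Ω) : ℕ → 𝓧 := fun i => X i ω

/-- `σ_n² = E(S_n²)`. -/
def sumVariance (P : Measure Ω) (X : ℤ → Ω → 𝓧) (g : 𝓧 → ℝ) (n : ℕ) : ℝ :=
  ∫ ω, (partialSum g n (forward X ω)) ^ 2 ∂P

/-- `‖E(S_n | X_0)‖`, the norm being that of `L²(P)`. -/
def condSumNorm (P : Measure Ω) (X : ℤ → Ω → 𝓧) (g : 𝓧 → ℝ) (n : ℕ) : ℝ :=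
  (eLpNorm (P[fun ω => partialSum g n (forward X ω) |
    MeasurableSpace.comap (X 0) inferInstance]) 2 P).toReal

/-- `P^x`: the law of the path `X_0, X_1, …` of the chain with transition kernel `Q` that is
started at `X_0 = x` (Ionescu-Tulcea). -/
def pathLaw (Q : Kernel 𝓧 𝓧) [IsMarkovKernel Q] (x : 𝓧) : Measure (ℕ → 𝓧) :=
  Kernel.traj (X := fun _ => 𝓧)
    (fun n => Q.comap
      (fun h : (i : Finset.Iic n) → 𝓧 => h ⟨n, Finset.mem_Iic.2 le_rfl⟩)
      (measurable_pi_apply _))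
    0 (fun _ => x)

end StationarySums

end

/-! The quenched limit comes first: for π-a.e. x, the partial sums up to time 2^N have under P^x a
common majorant whose L² norm is o(2^{N/2}). Chebyshev's inequality then gives the limit under P^x,
and averaging over π gives convergence in probability.

Fix a scale s and cut time into blocks of length 2^s. Up to one incomplete block, S_k is a
martingale made of centred block sums plus the sum of the conditional means of the blocks given
their starting points. Doob's inequality (`exists_majorant_martingale`) handles the martingale. The
conditional means are handled by dyadic chaining (`exists_majorant_dyadic`): if neighbours are
paired and the second is conditioned on the start of the pair, the tower property returns the same
kind of array for blocks of double length, and the error is a martingale difference. The maximum is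
thus controlled by a sum over scales s ≤ i ≤ N of square functions of f_i(x) = E^x(S_{2^i}), sampled
at multiples of 2^i. The incomplete block costs at most 2^s max |g|, which is truncated at a level
K. All this is assembled in `exists_majorant_blockSum`.

Under P^x the chain is not stationary, but the square functions are ergodic sums at x of the kernel
Q^{2^i}. Hopf's maximal inequality (`mul_measure_exists_lt_sum_le`) bounds all the averages of such
sums at once, off a set whose π-measure is controlled by the stationary mean. The rate assumption
gives ∫ f_i² dπ / 2^i = O(i^{-4}), so Borel–Cantelli permits the bounds 2^i w_i² with w_i =
(i+1)^{-5/4}; since the w_i are summable, chaining from scale s costs 2^{N/2} times a small tail.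
The block variances satisfy σ²_{2^s}/2^s → 0 without a rate, so Hopf's inequality yields only
infinitely many good scales s. That suffices, because one s is fixed before N tends to infinity. -/

noncomputable section

namespace StationarySums

/-! ### Hopf's maximal inequality for Markov kernels -/

section MaximalErgodic

variable {α : Type*} [MeasurableSpace α]

/-- The recursion `u_{n+1} = (d + K u_n - lam)⁺` behind the maximal ergodic inequality. -/
def excess (K : Kernel α α) (d : α → ℝ≥0∞) (lam : ℝ≥0∞) : ℕ → α → ℝ≥0∞
  | 0 => fun _ => 0
  | n + 1 => fun x => d x + ∫⁻ y, excess K d lam n y ∂(K x) - lam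

variable {K : Kernel α α} {d : α → ℝ≥0∞} {lam : ℝ≥0∞}

lemma measurable_excess (hd : Measurable d) (n : ℕ) : Measurable (excess K d lam n) := by
  induction n with
  | zero => exact measurable_const
  | succ n ih => exact (hd.add ih.lintegral_kernel).sub measurable_const

lemma excess_le_succ (n : ℕ) (x : α) : excess K d lam n x ≤ excess K d lam (n + 1) x := by
  induction n generalizing x with
  | zero => exact zero_le
  | succ n ih =>
    simp only [excess] at ih ⊢
    gcongr
    exact ih _

lemma lintegral_pow_succ (hd : Measurable d) (j : ℕ) (x : α) :
    ∫⁻ z, d z ∂((K ^ (j + 1)) x) = ∫⁻ y, ∫⁻ z, d z ∂((K ^ j) y) ∂(K x) := by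
  rw [pow_succ, ← Kernel.lintegral_comp _ _ _ hd]
  rfl

/-- Each step of the recursion subtracts `lam` and truncates at 0, so at most `lam` is lost per
step. The induction integrates the bound for k against `K x`; the constant `k * lam` survives
because K has total mass one. -/
lemma sum_lintegral_pow_le_excess [IsMarkovKernel K] (hd : Measurable d) (k : ℕ) (x : α) :
    ∑ j ∈ Finset.range k, ∫⁻ z, d z ∂((K ^ j) x) ≤ excess K d lam k x + k * lam := by
  induction k generalizing x with
  | zero => simp
  | succ k ih =>
    have hm : ∀ j, Measurable fun y => ∫⁻ z, d z ∂((K ^ j) y) := fun j => hd.lintegral_kernel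
    have h0 : ∫⁻ z, d z ∂((K ^ 0) x) = d x := by
      have h1 : (K ^ 0) = Kernel.id := pow_zero K
      rw [h1, Kernel.id_apply, lintegral_dirac' _ hd]
    rw [Finset.sum_range_succ', h0]
    simp_rw [lintegral_pow_succ hd]
    rw [← lintegral_finsetSum _ fun j _ => hm j]
    calc (∫⁻ y, ∑ j ∈ Finset.range k, ∫⁻ z, d z ∂((K ^ j) y) ∂(K x)) + d x
        ≤ (∫⁻ y, (excess K d lam k y + k * lam) ∂(K x)) + d x := by
          gcongr with y
          exact ih y
      _ = d x + ∫⁻ y, excess K d lam k y ∂(K x) + k * lam := by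
          rw [lintegral_add_left (measurable_excess hd k)]
          simp
          ring
      _ ≤ excess K d lam (k + 1) x + lam + k * lam :=
          add_le_add_left (le_tsub_add (a := lam) (b := d x + ∫⁻ y, excess K d lam k y ∂(K x))) _
      _ = excess K d lam (k + 1) x + ((k + 1 : ℕ) : ℝ≥0∞) * lam := by
          push_cast
          ring

lemma lintegral_invariant {p : Measure α} (hK : K.Invariant p) (hd : Measurable d) :
    ∫⁻ x, ∫⁻ y, d y ∂(K x) ∂p = ∫⁻ x, d x ∂p := by
  conv_rhs => rw [← hK.def]
  rw [Measure.lintegral_bind K.measurable.aemeasurable hd.aemeasurable]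

lemma lintegral_excess_ne_top {p : Measure α} (hK : K.Invariant p) (hd : Measurable d)
    (hfin : ∫⁻ x, d x ∂p ≠ ∞) (n : ℕ) : ∫⁻ x, excess K d lam n x ∂p ≠ ∞ := by
  induction n with
  | zero => simp [excess]
  | succ n ih =>
    refine ne_top_of_le_ne_top (ENNReal.add_ne_top.2 ⟨hfin, ih⟩) ?_
    rw [← lintegral_invariant hK (measurable_excess hd n), ← lintegral_add_left hd]
    exact lintegral_mono fun x => tsub_le_self

/-- Garsia's argument: where u_{n+1} is positive, u_{n+1} + lam = d + K u_n with no truncation.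
Integrating, invariance turns ∫ K u_n into ∫ u_n ≤ ∫ u_{n+1}, and this finite quantity cancels from
both sides. -/
lemma mul_measure_excess_pos_le {p : Measure α} (hK : K.Invariant p) (hd : Measurable d)
    (n : ℕ) : lam * p {x | 0 < excess K d lam n x} ≤ ∫⁻ x, d x ∂p := by
  by_cases hfin : ∫⁻ x, d x ∂p = ∞
  · simp [hfin]
  cases n with
  | zero => simp [excess]
  | succ n =>
    set A := {x | 0 < excess K d lam (n + 1) x} with hA
    have hmA : MeasurableSet A := measurableSet_lt measurable_const (measurable_excess hd _)
    have hu := measurable_excess (K := K) (lam := lam) hd n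
    have h1 : ∫⁻ x, excess K d lam (n + 1) x ∂p + lam * p A ≤
        ∫⁻ x, d x ∂p + ∫⁻ x, excess K d lam (n + 1) x ∂p := by
      calc ∫⁻ x, excess K d lam (n + 1) x ∂p + lam * p A
          = ∫⁻ x, (excess K d lam (n + 1) x + A.indicator (fun _ => lam) x) ∂p := by
            rw [lintegral_add_left (measurable_excess hd _), lintegral_indicator_const hmA]
        _ ≤ ∫⁻ x, (d x + ∫⁻ y, excess K d lam n y ∂(K x)) ∂p := by
            refine lintegral_mono fun x => ?_
            by_cases hx : x ∈ A
            · rw [Set.indicator_of_mem hx]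
              have : lam ≤ d x + ∫⁻ y, excess K d lam n y ∂(K x) :=
                (tsub_pos_iff_lt.1 hx).le
              exact (tsub_add_cancel_of_le this).le
            · rw [Set.indicator_of_notMem hx, add_zero]
              exact tsub_le_self
        _ = ∫⁻ x, d x ∂p + ∫⁻ x, excess K d lam n x ∂p := by
            rw [lintegral_add_left hd, lintegral_invariant hK hu]
        _ ≤ _ := by
            gcongr with x
            exact excess_le_succ n x
    rw [add_comm] at h1
    exact (ENNReal.add_le_add_iff_right (lintegral_excess_ne_top hK hd hfin _)).1 h1

/-- **Hopf's maximal ergodic inequality** for a Markov kernel with an invariant measure. -/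
theorem mul_measure_exists_lt_sum_le [IsMarkovKernel K] {p : Measure α} (hK : K.Invariant p)
    (hd : Measurable d) (lam : ℝ≥0∞) :
    lam * p {x | ∃ k : ℕ, k * lam < ∑ j ∈ Finset.range k, ∫⁻ z, d z ∂((K ^ j) x)} ≤
      ∫⁻ x, d x ∂p := by
  have hsub : {x | ∃ k : ℕ, k * lam < ∑ j ∈ Finset.range k, ∫⁻ z, d z ∂((K ^ j) x)} ⊆
      ⋃ n, {x | 0 < excess K d lam n x} := by
    rintro x ⟨k, hk⟩
    refine Set.mem_iUnion.2 ⟨k, ?_⟩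
    by_contra h
    have h0 : excess K d lam k x = 0 := by simpa using h
    have := sum_lintegral_pow_le_excess (lam := lam) (K := K) hd k x
    rw [h0, zero_add] at this
    exact absurd hk this.not_gt
  have hmono : Monotone fun n => {x | 0 < excess K d lam n x} :=
    monotone_nat_of_le_succ fun n x (hx : 0 < _) => hx.trans_le (excess_le_succ n x)
  calc lam * p _ ≤ lam * p (⋃ n, {x | 0 < excess K d lam n x}) := by gcongr
    _ = ⨆ n, lam * p {x | 0 < excess K d lam n x} := by
        rw [hmono.measure_iUnion, ENNReal.mul_iSup]
    _ ≤ _ := iSup_le fun n => mul_measure_excess_pos_le hK hd n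

end MaximalErgodic

/-! ### Doob's L² inequality and dyadic chaining -/

section Chaining

variable {Ω : Type*} {m0 : MeasurableSpace Ω} {μ : Measure Ω}

lemma eLpNorm_two_sq (f : Ω → ℝ) : eLpNorm f 2 μ ^ 2 = ∫⁻ x, ‖f x‖ₑ ^ 2 ∂μ := by
  have := eLpNorm_nnreal_pow_eq_lintegral (μ := μ) (f := f) (p := 2) two_ne_zero
  simpa using this

lemma lintegral_enorm_sq_eq_ofReal {f : Ω → ℝ} (hf : MemLp f 2 μ) :
    ∫⁻ x, ‖f x‖ₑ ^ 2 ∂μ = ENNReal.ofReal (∫ x, f x ^ 2 ∂μ) := by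
  rw [ofReal_integral_eq_lintegral_ofReal hf.integrable_sq (ae_of_all _ fun x => sq_nonneg _)]
  refine lintegral_congr fun x => ?_
  rw [Real.enorm_eq_ofReal_abs, ← ENNReal.ofReal_pow (abs_nonneg _), sq_abs]

lemma memLp_two_of_lintegral {f : Ω → ℝ} (hf : AEStronglyMeasurable f μ)
    (h : ∫⁻ x, ‖f x‖ₑ ^ 2 ∂μ ≠ ∞) : MemLp f 2 μ := by
  refine ⟨hf, lt_top_iff_ne_top.2 fun htop => h ?_⟩
  rw [← eLpNorm_two_sq, htop]
  simp

lemma eLpNorm_two_le_of_sq_le {f : Ω → ℝ} {c : ℝ≥0∞} (h : ∫⁻ x, ‖f x‖ₑ ^ 2 ∂μ ≤ c ^ 2) :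
    eLpNorm f 2 μ ≤ c := by
  rw [← eLpNorm_two_sq] at h
  exact (ENNReal.pow_le_pow_left_iff two_ne_zero).1 h

/-- The running maximum of `|N|`. -/
def runningMax (N : ℕ → Ω → ℝ) : ℕ → Ω → ℝ
  | 0 => fun _ => 0
  | k + 1 => fun ω => max (runningMax N k ω) |N (k + 1) ω|

lemma abs_le_runningMax {N : ℕ → Ω → ℝ} (h0 : N 0 = 0) {k n : ℕ} (h : k ≤ n) (ω : Ω) :
    |N k ω| ≤ runningMax N n ω := by
  induction n with
  | zero => simp [Nat.le_zero.1 h, h0, runningMax]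
  | succ n ih =>
    rcases h.eq_or_lt with rfl | h
    · exact le_max_right _ _
    · exact (ih (Nat.lt_succ_iff.1 h)).trans (le_max_left _ _)

lemma runningMax_nonneg (N : ℕ → Ω → ℝ) (n : ℕ) (ω : Ω) : 0 ≤ runningMax N n ω := by
  induction n with
  | zero => exact le_rfl
  | succ n ih => exact ih.trans (le_max_left _ _)

/-- A pathwise form of Doob's inequality: the left side is a discrete stochastic integral with
predictable integrand, so it has mean zero for a martingale. In the induction, a step that raises
the maximum from m to |N_{n+1}| leaves the slack (m - |N_{n+1}|)²/2. -/
lemma sum_runningMax_mul_le {N : ℕ → Ω → ℝ} (n : ℕ) (ω : Ω) :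
    ∑ k ∈ Finset.range n, runningMax N k ω * SignType.sign (N k ω) * (N (k + 1) ω - N k ω) ≤
      runningMax N n ω * |N n ω| - runningMax N n ω ^ 2 / 2 := by
  induction n with
  | zero => simp [runningMax]
  | succ n ih =>
    rw [Finset.sum_range_succ]
    have ha := runningMax_nonneg N n ω
    have hs : (SignType.sign (N n ω) : ℝ) * N n ω = |N n ω| := by
      rw [sign_mul_self]
    have hs' : (SignType.sign (N n ω) : ℝ) * N (n + 1) ω ≤ |N (n + 1) ω| := by
      rcases lt_trichotomy (N n ω) 0 with h | h | h
      · simpa [h] using neg_le_abs (N (n + 1) ω)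
      · simp [h]
      · simpa [h] using le_abs_self (N (n + 1) ω)
    have h1 : runningMax N n ω * SignType.sign (N n ω) * (N (n + 1) ω - N n ω) ≤
        runningMax N n ω * (|N (n + 1) ω| - |N n ω|) := by
      rw [mul_assoc, mul_sub, hs]
      gcongr
    have h2 : runningMax N n ω * |N (n + 1) ω| - runningMax N n ω ^ 2 / 2 ≤
        runningMax N (n + 1) ω * |N (n + 1) ω| - runningMax N (n + 1) ω ^ 2 / 2 := by
      simp only [runningMax]
      rcases le_total (runningMax N n ω) |N (n + 1) ω| with h | h
      · rw [max_eq_right h]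
        nlinarith [sq_nonneg (runningMax N n ω - |N (n + 1) ω|)]
      · rw [max_eq_left h]
    linarith

lemma integral_mul_eq_zero {m : MeasurableSpace Ω} [IsFiniteMeasure μ] (hm : m ≤ m0)
    {H D : Ω → ℝ} (hH : StronglyMeasurable[m] H) (hH2 : MemLp H 2 μ) (hD2 : MemLp D 2 μ)
    (hD : μ[D | m] =ᵐ[μ] 0) : ∫ ω, H ω * D ω ∂μ = 0 := by
  have h1 : μ[H * D | m] =ᵐ[μ] H * μ[D | m] :=
    condExp_mul_of_stronglyMeasurable_left hH (hH2.integrable_mul hD2)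
      (hD2.integrable one_le_two)
  calc ∫ ω, H ω * D ω ∂μ = ∫ ω, (μ[H * D | m]) ω ∂μ := (integral_condExp hm).symm
    _ = ∫ ω, (0 : ℝ) ∂μ := by
        refine integral_congr_ae ?_
        filter_upwards [h1, hD] with ω h1 h2
        rw [h1, Pi.mul_apply, h2]
        simp
    _ = 0 := by simp

/-- Doob's maximal inequality in `L²` for a martingale with differences `D`. -/
theorem exists_majorant_martingale [IsFiniteMeasure μ] (ℱ : Filtration ℕ m0) {D : ℕ → Ω → ℝ}
    (hDm : ∀ j, StronglyMeasurable[ℱ (j + 1)] (D j)) (hD2 : ∀ j, MemLp (D j) 2 μ)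
    (hD : ∀ j, μ[D j | ℱ j] =ᵐ[μ] 0) (n : ℕ) :
    ∃ G : Ω → ℝ, MemLp G 2 μ ∧
      (∀ ω, ∀ k ≤ n, |∑ j ∈ Finset.range k, D j ω| ≤ G ω) ∧
      ∫⁻ ω, ‖G ω‖ₑ ^ 2 ∂μ ≤ 4 * ∑ j ∈ Finset.range n, ∫⁻ ω, ‖D j ω‖ₑ ^ 2 ∂μ := by
  set N : ℕ → Ω → ℝ := fun k ω => ∑ j ∈ Finset.range k, D j ω with hN
  have hNm : ∀ k, StronglyMeasurable[ℱ k] (N k) := fun k => by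
    refine Finset.stronglyMeasurable_fun_sum _ fun j hj => (hDm j).mono (ℱ.mono ?_)
    exact Finset.mem_range.1 hj
  have hN2 : ∀ k, MemLp (N k) 2 μ := fun k => memLp_finsetSum _ fun j _ => hD2 j
  have hNs : ∀ k ω, N (k + 1) ω - N k ω = D k ω := fun k ω => by
    simp [hN, Finset.sum_range_succ]
  have hGm : ∀ k, StronglyMeasurable[ℱ k] (runningMax N k) := fun k => by
    induction k with
    | zero => exact stronglyMeasurable_const
    | succ k ih =>
      exact continuous_max.comp_stronglyMeasurable ((ih.mono (ℱ.mono k.le_succ)).prodMk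
        (continuous_abs.comp_stronglyMeasurable (hNm (k + 1))))
  have hG2 : ∀ k, MemLp (runningMax N k) 2 μ := fun k => by
    induction k with
    | zero => exact MemLp.zero
    | succ k ih => exact ih.sup (hN2 (k + 1)).norm
  have hNsq : ∀ k, ∫ ω, N k ω ^ 2 ∂μ = ∑ j ∈ Finset.range k, ∫ ω, D j ω ^ 2 ∂μ := fun k => by
    induction k with
    | zero => simp [hN]
    | succ k ih =>
      have h0 := integral_mul_eq_zero (ℱ.le k) (hNm k) (hN2 k) (hD2 k) (hD k)
      have hi : Integrable (fun ω => N k ω * D k ω) μ := (hN2 k).integrable_mul (hD2 k)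
      rw [Finset.sum_range_succ, ← ih]
      calc ∫ ω, N (k + 1) ω ^ 2 ∂μ
          = ∫ ω, (N k ω ^ 2 + (2 * (N k ω * D k ω) + D k ω ^ 2)) ∂μ := by
            refine integral_congr_ae (ae_of_all _ fun ω => ?_)
            have := hNs k ω
            have h : N (k + 1) ω = N k ω + D k ω := by linarith
            simp only [h]
            ring
        _ = _ := by
            have hi2 : Integrable (fun ω => 2 * (N k ω * D k ω) + D k ω ^ 2) μ :=
              (hi.const_mul 2).add (hD2 k).integrable_sq
            rw [integral_add (hN2 k).integrable_sq hi2,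
              integral_add (hi.const_mul 2) (hD2 k).integrable_sq, integral_const_mul, h0]
            ring
  have hsm : Measurable fun x : ℝ => ((SignType.sign x : SignType) : ℝ) := by
    have : (fun x : ℝ => ((SignType.sign x : SignType) : ℝ)) =
        fun x => (Set.Ioi (0 : ℝ)).indicator 1 x - (Set.Iio (0 : ℝ)).indicator 1 x := by
      ext x
      rcases lt_trichotomy x 0 with h | h | h
      · simp [h, not_lt.2 h.le]
      · simp [h]
      · simp [h, not_lt.2 h.le]
    rw [this]
    exact (measurable_one.indicator measurableSet_Ioi).sub
      (measurable_one.indicator measurableSet_Iio)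
  have hHm : ∀ k, StronglyMeasurable[ℱ k]
      (fun ω => runningMax N k ω * (SignType.sign (N k ω) : ℝ)) := fun k =>
    (hGm k).mul (hsm.comp (hNm k).measurable).stronglyMeasurable
  have hH2 : ∀ k, MemLp (fun ω => runningMax N k ω * (SignType.sign (N k ω) : ℝ)) 2 μ :=
    fun k => (hG2 k).of_le ((hHm k).mono (ℱ.le k)).aestronglyMeasurable <| ae_of_all _ fun ω => by
      rw [norm_mul]
      refine mul_le_of_le_one_right (norm_nonneg _) ?_
      rcases lt_trichotomy (N k ω) 0 with h | h | h <;> simp [h]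
  have hint : ∀ k, Integrable
      (fun ω => runningMax N k ω * (SignType.sign (N k ω) : ℝ) * (N (k + 1) ω - N k ω)) μ :=
    fun k => by
      simp_rw [hNs]
      exact (hH2 k).integrable_mul (hD2 k)
  have hzero : ∫ ω, ∑ k ∈ Finset.range n,
      runningMax N k ω * (SignType.sign (N k ω) : ℝ) * (N (k + 1) ω - N k ω) ∂μ = 0 := by
    rw [integral_finsetSum _ fun k _ => hint k]
    refine Finset.sum_eq_zero fun k _ => ?_
    simp_rw [hNs]
    exact integral_mul_eq_zero (ℱ.le k) (hHm k) (hH2 k) (hD2 k) (hD k)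
  have hkey : ∫ ω, runningMax N n ω ^ 2 ∂μ ≤ 4 * ∫ ω, N n ω ^ 2 ∂μ := by
    -- With m the running maximum, m|N| - m²/2 ≤ N² - m²/4 is (m - 2|N|)² ≥ 0; integrating gives
    -- Doob's constant 4.
    have hpt : ∀ ω, ∑ k ∈ Finset.range n,
        runningMax N k ω * (SignType.sign (N k ω) : ℝ) * (N (k + 1) ω - N k ω) ≤
        N n ω ^ 2 - (1 / 4) * runningMax N n ω ^ 2 := fun ω => by
      refine (sum_runningMax_mul_le n ω).trans ?_
      nlinarith [sq_nonneg (runningMax N n ω - 2 * |N n ω|), sq_abs (N n ω)]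
    have := integral_mono (integrable_finsetSum _ fun k _ => hint k)
      ((hN2 n).integrable_sq.sub ((hG2 n).integrable_sq.const_mul (1 / 4))) hpt
    rw [hzero] at this
    simp only [Pi.sub_apply] at this
    rw [integral_sub (hN2 n).integrable_sq ((hG2 n).integrable_sq.const_mul (1 / 4)),
      integral_const_mul] at this
    linarith
  have hN0 : N 0 = 0 := by
    ext
    simp [hN]
  refine ⟨runningMax N n, hG2 n, fun ω k hk => abs_le_runningMax hN0 hk ω, ?_⟩
  rw [lintegral_enorm_sq_eq_ofReal (hG2 n)]
  simp_rw [lintegral_enorm_sq_eq_ofReal (hD2 _)]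
  rw [← ENNReal.ofReal_sum_of_nonneg fun j _ => integral_nonneg fun ω => sq_nonneg _, ← hNsq,
    show (4 : ℝ≥0∞) = ENNReal.ofReal 4 by norm_num, ← ENNReal.ofReal_mul (by norm_num)]
  exact ENNReal.ofReal_le_ofReal hkey

/-- The filtration sampled along the multiples of `a`. -/
def sampled (ℱ : Filtration ℕ m0) (a : ℕ) : Filtration ℕ m0 where
  seq j := ℱ (j * a)
  mono' _ _ h := ℱ.mono (Nat.mul_le_mul_right a h)
  le' _ := ℱ.le _

lemma condExp_sub_condExp_ae_eq_zero [IsFiniteMeasure μ] {m : MeasurableSpace Ω} (hm : m ≤ m0)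
    {f : Ω → ℝ} (hf : Integrable f μ) : μ[f - μ[f | m] | m] =ᵐ[μ] 0 := by
  filter_upwards [condExp_sub hf integrable_condExp m,
    condExp_condExp_of_le (μ := μ) (f := f) le_rfl hm] with ω h1 h2
  rw [h1, Pi.sub_apply, h2]
  simp

/-- Triangle inequality and L² contractivity of conditional expectation. The factor 4 is not
optimal, but only its finiteness matters. -/
lemma lintegral_enorm_sub_condExp_sq_le {m : MeasurableSpace Ω} {f : Ω → ℝ}
    (hf : AEStronglyMeasurable[m0] f μ) :
    ∫⁻ ω, ‖(f - μ[f | m]) ω‖ₑ ^ 2 ∂μ ≤ 4 * ∫⁻ ω, ‖f ω‖ₑ ^ 2 ∂μ := by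
  rw [← eLpNorm_two_sq, ← eLpNorm_two_sq]
  calc eLpNorm (f - μ[f | m]) 2 μ ^ 2 ≤ (eLpNorm f 2 μ + eLpNorm f 2 μ) ^ 2 := by
        gcongr
        refine (eLpNorm_sub_le hf integrable_condExp.1 one_le_two).trans ?_
        gcongr
        exact eLpNorm_condExp_le_eLpNorm f one_le_two
    _ = 4 * eLpNorm f 2 μ ^ 2 := by ring

lemma sum_range_two_mul_add {f : ℕ → ℝ} (k : ℕ) :
    ∑ j ∈ Finset.range (2 * k), f j = ∑ j ∈ Finset.range k, (f (2 * j) + f (2 * j + 1)) := by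
  induction k with
  | zero => simp
  | succ k ih =>
    rw [Finset.sum_range_succ, ← ih, show 2 * (k + 1) = 2 * k + 1 + 1 by ring,
      Finset.sum_range_succ, Finset.sum_range_succ]
    ring

lemma sum_range_two_mul_odd_le {f : ℕ → ℝ≥0∞} (k : ℕ) :
    ∑ j ∈ Finset.range k, f (2 * j + 1) ≤ ∑ j ∈ Finset.range (2 * k), f j := by
  induction k with
  | zero => simp
  | succ k ih =>
    rw [Finset.sum_range_succ, show 2 * (k + 1) = 2 * k + 1 + 1 by ring,
      Finset.sum_range_succ, Finset.sum_range_succ]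
    gcongr
    exact ih.trans le_self_add

/-- A square integrable majorant of finitely many functions. -/
lemma exists_majorant_sqrt_sum {f : ℕ → Ω → ℝ} (hf : ∀ j, Measurable (f j)) (n : ℕ) :
    ∃ G : Ω → ℝ, Measurable G ∧ (∀ ω, ∀ j < n, |f j ω| ≤ G ω) ∧
      ∫⁻ ω, ‖G ω‖ₑ ^ 2 ∂μ = ∑ j ∈ Finset.range n, ∫⁻ ω, ‖f j ω‖ₑ ^ 2 ∂μ := by
  refine ⟨fun ω => √(∑ j ∈ Finset.range n, f j ω ^ 2),
    (Finset.measurable_fun_sum _ fun j _ => (hf j).pow_const 2).sqrt, fun ω j hj => ?_, ?_⟩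
  · exact Real.abs_le_sqrt (Finset.single_le_sum (f := fun j => f j ω ^ 2)
      (fun j _ => sq_nonneg _) (Finset.mem_range.2 hj))
  · rw [← lintegral_finsetSum _ fun j _ => (hf j).enorm.pow_const 2]
    refine lintegral_congr fun ω => ?_
    have hs : ∀ x : ℝ, ‖x‖ₑ ^ 2 = ENNReal.ofReal (x ^ 2) := fun x => by
      rw [Real.enorm_eq_ofReal_abs, ← ENNReal.ofReal_pow (abs_nonneg _), sq_abs]
    simp_rw [hs]
    rw [← ENNReal.ofReal_sum_of_nonneg fun j _ => sq_nonneg _,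
      Real.sq_sqrt (Finset.sum_nonneg fun j _ => sq_nonneg _)]

/-- Dyadic chaining: partial sums of the level `i₀` of an array in which each level is obtained
from the previous one by pairing consecutive terms and conditioning on the past of the pair. -/
theorem exists_majorant_dyadic [IsFiniteMeasure μ] (ℱ : Filtration ℕ m0) {e : ℕ → ℕ → Ω → ℝ}
    (hem : ∀ i j, StronglyMeasurable[ℱ (j * 2 ^ i)] (e i j)) (he2 : ∀ i j, MemLp (e i j) 2 μ)
    (he : ∀ i j, e (i + 1) j =ᵐ[μ] e i (2 * j) + μ[e i (2 * j + 1) | ℱ (j * 2 ^ (i + 1))])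
    (r i₀ : ℕ) (c : ℕ → ℝ≥0∞)
    (hc : ∀ i ≤ r, ∑ j ∈ Finset.range (2 ^ (r - i)), ∫⁻ ω, ‖e (i₀ + i) j ω‖ₑ ^ 2 ∂μ ≤ c i ^ 2) :
    ∃ G : Ω → ℝ, MemLp G 2 μ ∧
      (∀ᵐ ω ∂μ, ∀ k ≤ 2 ^ r, |∑ j ∈ Finset.range k, e i₀ j ω| ≤ G ω) ∧
      eLpNorm G 2 μ ≤ 5 * ∑ i ∈ Finset.range (r + 1), c i := by
  induction r generalizing i₀ c with
  | zero =>
    refine ⟨fun ω => |e i₀ 0 ω|, (he2 i₀ 0).abs, ae_of_all _ fun ω k hk => ?_, ?_⟩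
    · interval_cases k <;> simp
    · have h := hc 0 le_rfl
      simp only [Nat.sub_self, pow_zero, Finset.range_one, Finset.sum_singleton,
        add_zero] at h
      have h2 : eLpNorm (fun ω => |e i₀ 0 ω|) 2 μ ≤ c 0 := by
        rw [show (fun ω => |e i₀ 0 ω|) = fun ω => ‖e i₀ 0 ω‖ from rfl, eLpNorm_norm]
        exact eLpNorm_two_le_of_sq_le h
      simp only [zero_add, Finset.range_one, Finset.sum_singleton]
      exact h2.trans (le_mul_of_one_le_left zero_le (by norm_num))
  | succ r ih =>
    obtain ⟨G₁, hG₁, hb₁, hn₁⟩ := ih (i₀ + 1) (fun i => c (i + 1)) fun i hi => by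
      have := hc (i + 1) (by omega)
      rwa [show r + 1 - (i + 1) = r - i by omega, show i₀ + (i + 1) = i₀ + 1 + i by ring] at this
    have hle : ∀ j, j * 2 ^ (i₀ + 1) = 2 * j * 2 ^ i₀ := fun j => by ring
    -- The second term of each pair, centred given the past at the start of the pair: a martingale
    -- difference along the multiples of 2^{i₀+1}.
    set D : ℕ → Ω → ℝ := fun j =>
      e i₀ (2 * j + 1) - μ[e i₀ (2 * j + 1) | ℱ (j * 2 ^ (i₀ + 1))] with hDdef
    have hlt : ∀ j, (2 * j + 1) * 2 ^ i₀ ≤ (j + 1) * 2 ^ (i₀ + 1) := fun j => by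
      rw [hle]
      gcongr
      omega
    have hlt' : ∀ j, j * 2 ^ (i₀ + 1) ≤ (j + 1) * 2 ^ (i₀ + 1) := fun j => by
      gcongr
      omega
    obtain ⟨G₂, hG₂, hb₂, hn₂⟩ := exists_majorant_martingale (sampled ℱ (2 ^ (i₀ + 1)))
      (D := D) (fun j => ((hem i₀ (2 * j + 1)).mono (ℱ.mono (hlt j))).sub
        (stronglyMeasurable_condExp.mono (ℱ.mono (hlt' j))))
      (fun j => (he2 _ _).sub ((he2 _ _).condExp one_le_two))
      (fun j => condExp_sub_condExp_ae_eq_zero (ℱ.le _) ((he2 _ _).integrable one_le_two)) (2 ^ r)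
    have hm : ∀ j, Measurable (e i₀ j) := fun j => ((hem i₀ j).mono (ℱ.le _)).measurable
    have hc0 := hc 0 (Nat.zero_le _)
    simp only [Nat.sub_zero, add_zero] at hc0
    obtain ⟨G₃, hG₃m, hb₃, hG₃n⟩ := exists_majorant_sqrt_sum (μ := μ) hm (2 ^ (r + 1))
    have hG₃ : MemLp G₃ 2 μ := by
      refine memLp_two_of_lintegral hG₃m.aestronglyMeasurable ?_
      rw [hG₃n, ENNReal.sum_ne_top]
      intro j _
      rw [lintegral_enorm_sq_eq_ofReal (he2 _ _)]
      exact ENNReal.ofReal_ne_top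
    -- A factor 2 from Doob and a factor 2 from centring. The unpaired last term contributes one
    -- more `c 0`, which is where the constant 5 comes from.
    have hn₂' : eLpNorm G₂ 2 μ ≤ 4 * c 0 := by
      refine eLpNorm_two_le_of_sq_le (hn₂.trans ?_)
      calc 4 * ∑ j ∈ Finset.range (2 ^ r), ∫⁻ ω, ‖D j ω‖ₑ ^ 2 ∂μ
          ≤ 4 * ∑ j ∈ Finset.range (2 ^ r), 4 * ∫⁻ ω, ‖e i₀ (2 * j + 1) ω‖ₑ ^ 2 ∂μ := by
            gcongr with j
            exact lintegral_enorm_sub_condExp_sq_le (he2 _ _).1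
        _ = 16 * ∑ j ∈ Finset.range (2 ^ r), ∫⁻ ω, ‖e i₀ (2 * j + 1) ω‖ₑ ^ 2 ∂μ := by
            rw [← Finset.mul_sum, ← mul_assoc]
            norm_num
        _ ≤ 16 * c 0 ^ 2 := by
            gcongr
            refine (sum_range_two_mul_odd_le
              (f := fun j => ∫⁻ ω, ‖e i₀ j ω‖ₑ ^ 2 ∂μ) _).trans ?_
            rwa [← pow_succ']
        _ = (4 * c 0) ^ 2 := by ring
    refine ⟨G₁ + G₂ + G₃, (hG₁.add hG₂).add hG₃, ?_, ?_⟩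
    · filter_upwards [hb₁, ae_all_iff.2 fun j => he i₀ j] with ω h1 h2 k hk
      have hpair : ∀ k, ∑ j ∈ Finset.range (2 * k), e i₀ j ω =
          ∑ j ∈ Finset.range k, e (i₀ + 1) j ω + ∑ j ∈ Finset.range k, D j ω := fun k => by
        rw [sum_range_two_mul_add, ← Finset.sum_add_distrib]
        refine Finset.sum_congr rfl fun j _ => ?_
        rw [h2 j, hDdef]
        simp only [Pi.add_apply, Pi.sub_apply]
        ring
      -- For odd k one term remains unpaired; `G₃` dominates every single term.
      have hodd : |∑ j ∈ Finset.range k, e i₀ j ω -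
          ∑ j ∈ Finset.range (2 * (k / 2)), e i₀ j ω| ≤ G₃ ω := by
        rcases Nat.even_or_odd' k with ⟨l, rfl | rfl⟩
        · simpa using (abs_nonneg _).trans (hb₃ ω 0 (by positivity))
        · rw [show (2 * l + 1) / 2 = l by omega, Finset.sum_range_succ, add_sub_cancel_left]
          exact hb₃ ω _ (by omega)
      have hk2 : k / 2 ≤ 2 ^ r := by
        rw [pow_succ] at hk
        omega
      rw [hpair] at hodd
      have := abs_sub_abs_le_abs_sub (∑ j ∈ Finset.range k, e i₀ j ω)
        (∑ j ∈ Finset.range (k / 2), e (i₀ + 1) j ω + ∑ j ∈ Finset.range (k / 2), D j ω)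
      have h3 := abs_add_le (∑ j ∈ Finset.range (k / 2), e (i₀ + 1) j ω)
        (∑ j ∈ Finset.range (k / 2), D j ω)
      have h4 := h1 (k / 2) hk2
      have h5 := hb₂ ω (k / 2) hk2
      simp only [Pi.add_apply]
      linarith
    · calc eLpNorm (G₁ + G₂ + G₃) 2 μ ≤ eLpNorm G₁ 2 μ + eLpNorm G₂ 2 μ + eLpNorm G₃ 2 μ :=
            (eLpNorm_add_le (hG₁.add hG₂).1 hG₃.1 one_le_two).trans
              (by gcongr; exact eLpNorm_add_le hG₁.1 hG₂.1 one_le_two)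
        _ ≤ 5 * ∑ i ∈ Finset.range (r + 1), c (i + 1) + 4 * c 0 + c 0 := by
            gcongr
            exact eLpNorm_two_le_of_sq_le (hG₃n.trans_le hc0)
        _ = 5 * ∑ i ∈ Finset.range (r + 1 + 1), c i := by
            rw [Finset.sum_range_succ' _ (r + 1)]
            ring

end Chaining

/-! ### Markov chains, their path laws, and uniqueness of the law -/

section Markov

variable {Ω 𝓧 : Type*} {m0 : MeasurableSpace Ω} [MeasurableSpace 𝓧]

instance isMarkovKernel_pow (K : Kernel 𝓧 𝓧) [IsMarkovKernel K] (m : ℕ) :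
    IsMarkovKernel (K ^ m) := by
  induction m with
  | zero => exact inferInstanceAs (IsMarkovKernel (Kernel.id : Kernel 𝓧 𝓧))
  | succ m ih =>
    rw [pow_succ]
    exact inferInstanceAs (IsMarkovKernel ((K ^ m) ∘ₖ K))

lemma invariant_pow {K : Kernel 𝓧 𝓧} {p : Measure 𝓧} (hK : K.Invariant p) (m : ℕ) :
    (K ^ m).Invariant p := by
  induction m with
  | zero => exact Measure.id_comp
  | succ m ih =>
    rw [pow_succ]
    exact Kernel.Invariant.comp ih hK

lemma integral_measure_comp {κ : Kernel 𝓧 𝓧} [IsMarkovKernel κ] {ν : Measure 𝓧}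
    [IsFiniteMeasure ν] {f : 𝓧 → ℝ} (hf : Integrable f (κ ∘ₘ ν)) :
    Integrable (fun x => ∫ y, f y ∂(κ x)) ν ∧
      ∫ y, f y ∂(κ ∘ₘ ν) = ∫ x, ∫ y, f y ∂(κ x) ∂ν := by
  rw [Measure.comp_eq_comp_const_apply] at hf ⊢
  refine ⟨by simpa using hf.integral_comp, ?_⟩
  rw [ProbabilityTheory.Kernel.integral_comp hf]
  simp

/-- `Y` is, with respect to the filtration `ℱ`, a homogeneous Markov chain with kernel `Q`. -/
structure IsMarkovChain (Q : Kernel 𝓧 𝓧) (μ : Measure Ω) (ℱ : Filtration ℕ m0)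
    (Y : ℕ → Ω → 𝓧) : Prop where
  adapted : ∀ n, Measurable[ℱ n] (Y n)
  step : ∀ n A, MeasurableSet[ℱ n] A → ∀ B, MeasurableSet B →
    μ (A ∩ Y (n + 1) ⁻¹' B) = ∫⁻ ω in A, Q (Y n ω) B ∂μ

namespace IsMarkovChain

variable {Q : Kernel 𝓧 𝓧} {μ : Measure Ω} {ℱ : Filtration ℕ m0} {Y : ℕ → Ω → 𝓧}

lemma measurable (h : IsMarkovChain Q μ ℱ Y) (n : ℕ) : Measurable (Y n) :=
  (h.adapted n).mono (ℱ.le n) le_rfl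

/-- Restricting μ to an event of the past encodes the m-step Markov property as an identity of
measures; `condExp_add` obtains conditional expectations by letting A vary. -/
lemma map_restrict_add (h : IsMarkovChain Q μ ℱ Y) {n : ℕ} {A : Set Ω}
    (hA : MeasurableSet[ℱ n] A) (m : ℕ) :
    (μ.restrict A).map (Y (n + m)) = (Q ^ m) ∘ₘ ((μ.restrict A).map (Y n)) := by
  induction m with
  | zero =>
    rw [pow_zero]
    exact Measure.id_comp.symm
  | succ m ih =>
    have : Q ^ (m + 1) = Q ∘ₖ (Q ^ m) := pow_succ' Q m
    rw [this, ← Measure.comp_assoc, ← ih]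
    ext B hB
    rw [Measure.map_apply (h.measurable _) hB, Measure.bind_apply hB Q.measurable.aemeasurable,
      lintegral_map (Q.measurable_coe hB) (h.measurable _),
      Measure.restrict_apply (h.measurable _ hB), Set.inter_comm]
    exact h.step (n + m) A (ℱ.mono (Nat.le_add_right n m) A hA) B hB

lemma map_add (h : IsMarkovChain Q μ ℱ Y) (n m : ℕ) :
    μ.map (Y (n + m)) = (Q ^ m) ∘ₘ (μ.map (Y n)) := by
  simpa using h.map_restrict_add (n := n) (@MeasurableSet.univ _ (ℱ n)) m

lemma condExp_add [IsMarkovKernel Q] [IsFiniteMeasure μ] (h : IsMarkovChain Q μ ℱ Y) {f : 𝓧 → ℝ}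
    (hf : Measurable f) {n m : ℕ} (hi : Integrable (fun ω => f (Y (n + m) ω)) μ) :
    μ[fun ω => f (Y (n + m) ω) | ℱ n] =ᵐ[μ] fun ω => ∫ y, f y ∂((Q ^ m) (Y n ω)) := by
  have hsm : StronglyMeasurable fun x => ∫ y, f y ∂((Q ^ m) x) :=
    hf.stronglyMeasurable.integral_kernel (κ := Q ^ m)
  have key : ∀ A, MeasurableSet[ℱ n] A →
      Integrable (fun x => ∫ y, f y ∂((Q ^ m) x)) ((μ.restrict A).map (Y n)) ∧
      ∫ ω in A, f (Y (n + m) ω) ∂μ =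
        ∫ x, ∫ y, f y ∂((Q ^ m) x) ∂((μ.restrict A).map (Y n)) := fun A hA => by
    have hI : Integrable f (((μ.restrict A).map (Y n)).bind (Q ^ m : Kernel 𝓧 𝓧)) := by
      rw [← h.map_restrict_add hA]
      exact (integrable_map_measure hf.aestronglyMeasurable (h.measurable _).aemeasurable).2
        hi.restrict
    obtain ⟨h1, h2⟩ := integral_measure_comp hI
    refine ⟨h1, ?_⟩
    rw [← h2, ← h.map_restrict_add hA,
      integral_map (h.measurable _).aemeasurable hf.aestronglyMeasurable]
  refine (ae_eq_condExp_of_forall_setIntegral_eq (ℱ.le n) hi (fun A hA _ => ?_)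
    (fun A hA _ => ?_) ?_).symm
  · exact (integrable_map_measure hsm.aestronglyMeasurable (h.measurable _).aemeasurable).1
      (key A hA).1
  · rw [(key A hA).2, integral_map (h.measurable _).aemeasurable hsm.aestronglyMeasurable]
  · exact (hsm.comp_measurable (h.adapted n)).aestronglyMeasurable

/-- The filtration shifted by `a`. -/
def shiftFiltration (ℱ : Filtration ℕ m0) (a : ℕ) : Filtration ℕ m0 where
  seq j := ℱ (a + j)
  mono' _ _ h := ℱ.mono (Nat.add_le_add_left h a)
  le' _ := ℱ.le _

lemma shift (h : IsMarkovChain Q μ ℱ Y) (a : ℕ) :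
    IsMarkovChain Q μ (shiftFiltration ℱ a) (fun k => Y (a + k)) where
  adapted n := h.adapted (a + n)
  step n := h.step (a + n)

end IsMarkovChain

/-- The kernel sending a history `x_0, …, x_n` to the law `Q(x_n, ·)` of the next state. -/
abbrev lastStep (Q : Kernel 𝓧 𝓧) (n : ℕ) : Kernel ((_ : Finset.Iic n) → 𝓧) 𝓧 :=
  Q.comap (fun h : (i : Finset.Iic n) → 𝓧 => h ⟨n, Finset.mem_Iic.2 le_rfl⟩)
    (measurable_pi_apply _)

/-- The laws `P^x` as a kernel. -/
def pathKernel (Q : Kernel 𝓧 𝓧) [IsMarkovKernel Q] : Kernel 𝓧 (ℕ → 𝓧) :=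
  (Kernel.traj (X := fun _ => 𝓧) (lastStep Q) 0).comap (fun x _ => x)
    (measurable_pi_lambda _ fun _ => measurable_id)

instance (Q : Kernel 𝓧 𝓧) [IsMarkovKernel Q] : IsMarkovKernel (pathKernel Q) := by
  unfold pathKernel
  infer_instance

lemma pathKernel_apply (Q : Kernel 𝓧 𝓧) [IsMarkovKernel Q] (x : 𝓧) :
    pathKernel Q x = pathLaw Q x := rfl

instance (Q : Kernel 𝓧 𝓧) [IsMarkovKernel Q] (x : 𝓧) : IsProbabilityMeasure (pathLaw Q x) := by
  rw [← pathKernel_apply]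
  infer_instance

/-- This makes the maximal inequality for Markov chains available under P^x itself. The one-step
identity is the Ionescu-Tulcea disintegration at time n, evaluated on a rectangle. -/
lemma isMarkovChain_pathLaw (Q : Kernel 𝓧 𝓧) [IsMarkovKernel Q] (x : 𝓧) :
    IsMarkovChain Q (pathLaw Q x) (Filtration.piLE (X := fun _ => 𝓧)) (fun n y => y n) where
  adapted n := by
    rw [Filtration.piLE_eq_comap_frestrictLe]
    exact (measurable_pi_apply (⟨n, Finset.mem_Iic.2 le_rfl⟩ : Finset.Iic n)).comp
      (comap_measurable (Preorder.frestrictLe n))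
  step n A hA B hB := by
    rw [Filtration.piLE_eq_comap_frestrictLe] at hA
    obtain ⟨A', hA', rfl⟩ := hA
    have hm : Measurable (Preorder.frestrictLe (π := fun _ => 𝓧) n) := by fun_prop
    have h := Kernel.partialTraj_compProd_eq_map_traj (X := fun _ => 𝓧) (κ := lastStep Q)
      (Nat.zero_le n) (x₀ := fun _ => x)
    have h2 := congrArg (fun ν => ν (A' ×ˢ B)) h
    rw [Measure.compProd_apply_prod hA' hB, Measure.map_apply (by fun_prop) (hA'.prod hB),
      ← Kernel.traj_map_frestrictLe_apply, setLIntegral_map hA'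
        (Kernel.measurable_coe _ hB) hm] at h2
    exact h2.symm

lemma map_zero_pathLaw (Q : Kernel 𝓧 𝓧) [IsMarkovKernel Q] (x : 𝓧) :
    (pathLaw Q x).map (fun y => y 0) = Measure.dirac x := by
  have h := Kernel.traj_map_frestrictLe_apply (X := fun _ => 𝓧) (κ := lastStep Q) 0 0
    (fun _ => x)
  rw [Kernel.partialTraj_self, Kernel.id_apply] at h
  have h2 := congrArg (fun ν => ν.map
    (fun z : (_ : Finset.Iic 0) → 𝓧 => z ⟨0, Finset.mem_Iic.2 le_rfl⟩)) h
  rw [Measure.map_map (by fun_prop) (by fun_prop),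
    Measure.map_dirac' (measurable_pi_apply _)] at h2
  exact h2

/-- A history up to time `n` extended by one more state. -/
def extendHistory (n : ℕ) (p : ((_ : Finset.Iic n) → 𝓧) × 𝓧) : (_ : Finset.Iic (n + 1)) → 𝓧 :=
  fun i => if hi : (i : ℕ) ≤ n then p.1 ⟨i, Finset.mem_Iic.2 hi⟩ else p.2

lemma measurable_extendHistory (n : ℕ) : Measurable (extendHistory (𝓧 := 𝓧) n) := by
  refine measurable_pi_lambda _ fun i => ?_
  unfold extendHistory
  split_ifs
  · fun_prop
  · fun_prop

omit [MeasurableSpace 𝓧] in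
lemma extendHistory_frestrictLe (n : ℕ) :
    (fun y : ℕ → 𝓧 => extendHistory n (Preorder.frestrictLe (π := fun _ => 𝓧) n y, y (n + 1))) =
      Preorder.frestrictLe (π := fun _ => 𝓧) (n + 1) := by
  ext y i
  unfold extendHistory
  split_ifs with hi
  · rfl
  · have : (i : ℕ) = n + 1 := le_antisymm (Finset.mem_Iic.1 i.2) (by omega)
    simp [this]

lemma trajMeasure_eq_comp_pathKernel {ν : Measure 𝓧} [IsProbabilityMeasure ν] (Q : Kernel 𝓧 𝓧)
    [IsMarkovKernel Q] :
    Kernel.trajMeasure (X := fun _ => 𝓧) ν (lastStep Q) = pathKernel Q ∘ₘ ν := by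
  ext s hs
  rw [Kernel.trajMeasure, Measure.bind_apply hs (Kernel.aemeasurable _),
    Measure.bind_apply hs (Kernel.aemeasurable _),
    lintegral_map (Kernel.measurable_coe _ hs) (by fun_prop)]
  refine lintegral_congr fun x => ?_
  rw [pathKernel, Kernel.comap_apply]
  rfl

/-- The law of a Markov chain is determined by its kernel and its initial distribution. -/
theorem IsMarkovChain.map_path {Q : Kernel 𝓧 𝓧} [IsMarkovKernel Q] {μ : Measure Ω}
    [IsProbabilityMeasure μ] {ℱ : Filtration ℕ m0} {Y : ℕ → Ω → 𝓧}
    (h : IsMarkovChain Q μ ℱ Y) :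
    μ.map (fun ω k => Y k ω) = pathKernel Q ∘ₘ (μ.map (Y 0)) := by
  have hY : Measurable fun ω k => Y k ω := measurable_pi_lambda _ h.measurable
  have : IsProbabilityMeasure (μ.map (Y 0)) :=
    Measure.isProbabilityMeasure_map (h.measurable 0).aemeasurable
  have : IsProbabilityMeasure (μ.map fun ω k => Y k ω) :=
    Measure.isProbabilityMeasure_map hY.aemeasurable
  rw [← trajMeasure_eq_comp_pathKernel]
  set τ := Kernel.trajMeasure (X := fun _ => 𝓧) (μ.map (Y 0)) (lastStep Q) with hτ
  have hr : ∀ n : ℕ, Measurable (Preorder.frestrictLe (π := fun _ => 𝓧) n) := fun n => by fun_prop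
  -- Laws of the histories agree by induction: the joint law of a history and the next state is the
  -- law of the history composed with the kernel. Every finite set of times lies in an initial
  -- segment, so uniqueness of projective limits concludes.
  have key : ∀ n, (μ.map fun ω k => Y k ω).map (Preorder.frestrictLe (π := fun _ => 𝓧) n) =
      τ.map (Preorder.frestrictLe (π := fun _ => 𝓧) n) := fun n => by
    induction n with
    | zero =>
      rw [hτ, Kernel.trajMeasure, Measure.map_comp _ _ (hr 0), Kernel.traj_map_frestrictLe,
        Kernel.partialTraj_self, Measure.id_comp, Measure.map_map (hr 0) hY,
        Measure.map_map (by fun_prop) (h.measurable 0)]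
      congr 1
      ext ω i
      have : (i : ℕ) = 0 := Nat.le_zero.1 (Finset.mem_Iic.1 i.2)
      obtain rfl : i = ⟨0, Finset.mem_Iic.2 le_rfl⟩ := Subtype.ext this
      rfl
    | succ n ih =>
      have hp : Measurable fun y : ℕ → 𝓧 =>
        (Preorder.frestrictLe (π := fun _ => 𝓧) n y, y (n + 1)) :=
          (hr n).prodMk (measurable_pi_apply _)
      have h1 : ∀ ν : Measure (ℕ → 𝓧), ν.map (Preorder.frestrictLe (π := fun _ => 𝓧) (n + 1)) =
          (ν.map fun y => (Preorder.frestrictLe (π := fun _ => 𝓧) n y, y (n + 1))).map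
            (extendHistory n) := fun ν => by
        rw [Measure.map_map (measurable_extendHistory n) hp, ← extendHistory_frestrictLe]
        rfl
      rw [h1, h1]
      congr 1
      have h2 := Kernel.map_frestrictLe_trajMeasure_compProd_eq_map_trajMeasure
        (X := fun _ => 𝓧) (μ₀ := μ.map (Y 0)) (κ := lastStep Q) (a := n)
      rw [← hτ, ← ih] at h2
      rw [← h2]
      refine Measure.ext_prod fun {s t} hs ht => ?_
      rw [Measure.compProd_apply_prod hs ht, Measure.map_apply hp (hs.prod ht),
        Measure.map_apply hY (hp (hs.prod ht)), setLIntegral_map hs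
        (Kernel.measurable_coe _ ht) (hr n)]
      refine Eq.trans ?_ (setLIntegral_map (hr n hs)
        ((Kernel.measurable_coe (lastStep Q n) ht).comp (hr n)) hY).symm
      have hA : MeasurableSet[ℱ n] ((fun ω k => Y k ω) ⁻¹'
          (Preorder.frestrictLe (π := fun _ => 𝓧) n ⁻¹' s)) := by
        have : Measurable[ℱ n] (fun ω => Preorder.frestrictLe (π := fun _ => 𝓧) n
            (fun k => Y k ω)) :=
          @measurable_pi_lambda _ _ _ (ℱ n) _ _ fun i => (h.adapted i).mono
            (ℱ.mono (Finset.mem_Iic.1 i.2)) le_rfl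
        exact this hs
      exact h.step n _ hA t ht
  have hfd : ∀ I : Finset ℕ, (μ.map fun ω k => Y k ω).map (I.restrict (π := fun _ => 𝓧)) =
      τ.map (I.restrict (π := fun _ => 𝓧)) :=
    fun I => by
      have hI : I ⊆ Finset.Iic (I.sup id) := fun i hi =>
        Finset.mem_Iic.2 (Finset.le_sup (f := id) hi)
      have h2 : ∀ ν : Measure (ℕ → 𝓧), ν.map (I.restrict (π := fun _ => 𝓧)) =
          (ν.map (Preorder.frestrictLe (π := fun _ => 𝓧) (I.sup id))).map
            (Finset.restrict₂ (π := fun _ => 𝓧) hI) := fun ν => by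
        have hI2 : Measurable (Finset.restrict₂ (π := fun _ => 𝓧) hI) :=
          measurable_pi_lambda _ fun _ => measurable_pi_apply _
        exact (Measure.map_map hI2 (hr _)).symm
      rw [h2, h2, key]
  have h1 : IsProjectiveLimit (μ.map fun ω k => Y k ω) fun I : Finset ℕ => τ.map I.restrict := hfd
  have h2 : IsProjectiveLimit τ fun I : Finset ℕ => τ.map I.restrict := fun I => rfl
  exact h1.unique h2

end Markov

/-! ### Block sums and their conditional means -/

section BlockSums

variable {Ω 𝓧 : Type*} {m0 : MeasurableSpace Ω} [MeasurableSpace 𝓧]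

/-- `g(Y_{a+1}) + ⋯ + g(Y_{a+n})`. -/
def blockSum (g : 𝓧 → ℝ) (Y : ℕ → Ω → 𝓧) (a n : ℕ) (ω : Ω) : ℝ :=
  ∑ l ∈ Finset.range n, g (Y (a + 1 + l) ω)

omit [MeasurableSpace 𝓧] m0 in
lemma blockSum_add (g : 𝓧 → ℝ) (Y : ℕ → Ω → 𝓧) (a n k : ℕ) (ω : Ω) :
    blockSum g Y a (n + k) ω = blockSum g Y a n ω + blockSum g Y (a + n) k ω := by
  simp only [blockSum, Finset.sum_range_add]
  congr 1
  refine Finset.sum_congr rfl fun l _ => ?_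
  rw [show a + 1 + (n + l) = a + n + 1 + l by ring]

omit [MeasurableSpace 𝓧] m0 in
lemma partialSum_eq_blockSum (g : 𝓧 → ℝ) (Y : ℕ → Ω → 𝓧) (n : ℕ) (ω : Ω) :
    partialSum g n (fun k => Y k ω) = blockSum g Y 0 n ω := by
  unfold partialSum blockSum
  induction n with
  | zero => simp
  | succ n ih =>
    rw [Finset.sum_Icc_succ_top (by omega), ih, Finset.sum_range_succ]
    congr 3
    ring

omit [MeasurableSpace 𝓧] m0 in
lemma blockSum_mul (g : 𝓧 → ℝ) (Y : ℕ → Ω → 𝓧) (b k : ℕ) (ω : Ω) :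
    blockSum g Y 0 (k * b) ω = ∑ j ∈ Finset.range k, blockSum g Y (j * b) b ω := by
  induction k with
  | zero => simp [blockSum]
  | succ k ih => rw [Finset.sum_range_succ, ← ih, Nat.succ_mul, blockSum_add, Nat.zero_add]

/-- `x ↦ E^x(S_{2^i})`. -/
def condMean (Q : Kernel 𝓧 𝓧) (g : 𝓧 → ℝ) : ℕ → 𝓧 → ℝ
  | 0 => fun x => ∫ y, g y ∂(Q x)
  | i + 1 => fun x => condMean Q g i x + ∫ y, condMean Q g i y ∂((Q ^ (2 ^ i)) x)

variable {Q : Kernel 𝓧 𝓧} [IsMarkovKernel Q] {g : 𝓧 → ℝ}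

omit [IsMarkovKernel Q] in
lemma measurable_condMean (hg : Measurable g) (i : ℕ) : Measurable (condMean Q g i) := by
  induction i with
  | zero => exact hg.stronglyMeasurable.integral_kernel.measurable
  | succ i ih =>
    exact ih.add (ih.stronglyMeasurable.integral_kernel (κ := Q ^ 2 ^ i)).measurable

variable {μ : Measure Ω} [IsProbabilityMeasure μ] {ℱ : Filtration ℕ m0} {Y : ℕ → Ω → 𝓧}

omit [MeasurableSpace 𝓧] [IsProbabilityMeasure μ] in
lemma memLp_blockSum (hY2 : ∀ k, MemLp (fun ω => g (Y k ω)) 2 μ) (a n : ℕ) :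
    MemLp (blockSum g Y a n) 2 μ :=
  memLp_finsetSum _ fun _ _ => hY2 _

namespace IsMarkovChain

/-- Doubling: the second half is conditioned first at the midpoint, where the induction hypothesis
applies, then at the start, which applies the kernel Q^{2^i}. This matches the recursion for
`condMean`. -/
lemma condExp_blockSum (h : IsMarkovChain Q μ ℱ Y) (hg : Measurable g)
    (hY2 : ∀ k, MemLp (fun ω => g (Y k ω)) 2 μ) (i a : ℕ) :
    μ[blockSum g Y a (2 ^ i) | ℱ a] =ᵐ[μ] fun ω => condMean Q g i (Y a ω) := by
  induction i generalizing a with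
  | zero =>
    have := h.condExp_add hg (n := a) (m := 1) ((hY2 _).integrable one_le_two)
    have hone : blockSum g Y a (2 ^ 0) = fun ω => g (Y (a + 1) ω) := by
      ext ω
      simp [blockSum]
    rw [pow_one] at this
    rw [hone]
    exact this
  | succ i ih =>
    have hint : ∀ a n, Integrable (blockSum g Y a n) μ :=
      fun a n => (memLp_blockSum hY2 a n).integrable one_le_two
    have hsplit : blockSum g Y a (2 ^ (i + 1)) =
        blockSum g Y a (2 ^ i) + blockSum g Y (a + 2 ^ i) (2 ^ i) := by
      ext ω
      rw [pow_succ, mul_two, blockSum_add]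
      rfl
    have h1 : μ[blockSum g Y (a + 2 ^ i) (2 ^ i) | ℱ a] =ᵐ[μ]
        fun ω => ∫ y, condMean Q g i y ∂((Q ^ (2 ^ i)) (Y a ω)) := by
      have hi : Integrable (fun ω => condMean Q g i (Y (a + 2 ^ i) ω)) μ :=
        integrable_condExp.congr (ih (a + 2 ^ i))
      exact (condExp_condExp_of_le (ℱ.mono (Nat.le_add_right _ _)) (ℱ.le _)).symm.trans
        ((condExp_congr_ae (ih (a + 2 ^ i))).trans
          (h.condExp_add (measurable_condMean hg i) hi))
    rw [hsplit]
    filter_upwards [MeasureTheory.condExp_add (hint a (2 ^ i)) (hint (a + 2 ^ i) (2 ^ i)) (ℱ a),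
      ih a, h1] with ω h2 h3 h4
    rw [h2, Pi.add_apply, h3, h4]
    rfl

lemma memLp_condMean (h : IsMarkovChain Q μ ℱ Y) (hg : Measurable g)
    (hY2 : ∀ k, MemLp (fun ω => g (Y k ω)) 2 μ) (i a : ℕ) :
    MemLp (fun ω => condMean Q g i (Y a ω)) 2 μ :=
  ((memLp_blockSum hY2 a (2 ^ i)).condExp one_le_two).ae_eq (h.condExp_blockSum hg hY2 i a)

/-- Law of a squared block sum, in terms of the chain restarted at the beginning of the block. -/
lemma lintegral_blockSum (h : IsMarkovChain Q μ ℱ Y) (hg : Measurable g) (a n : ℕ) :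
    ∫⁻ ω, ‖blockSum g Y a n ω‖ₑ ^ 2 ∂μ =
      ∫⁻ x, ∫⁻ y, ‖partialSum g n y‖ₑ ^ 2 ∂(pathLaw Q x) ∂(μ.map (Y a)) := by
  have hS : Measurable fun y : ℕ → 𝓧 => ‖partialSum g n y‖ₑ ^ 2 := by
    unfold partialSum
    fun_prop
  have hpath : Measurable fun ω k => Y (a + k) ω :=
    measurable_pi_lambda _ fun k => h.measurable _
  have h1 := (h.shift a).map_path
  have h2 : ∀ ω, blockSum g Y a n ω = partialSum g n (fun k => Y (a + k) ω) := fun ω => by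
    rw [partialSum_eq_blockSum g (fun k => Y (a + k))]
    refine Finset.sum_congr rfl fun l _ => ?_
    rw [zero_add, add_assoc]
  simp_rw [h2]
  rw [← lintegral_map hS hpath, h1, Measure.lintegral_bind (Kernel.aemeasurable _)
    hS.aemeasurable]
  rfl

end IsMarkovChain

end BlockSums

/-! ### The stationary chain as a Markov chain with invariant law π -/

section Stationary

variable {Ω 𝓧 : Type*} [MeasurableSpace Ω] [MeasurableSpace 𝓧]
  {P : Measure Ω} [IsProbabilityMeasure P] {X : ℤ → Ω → 𝓧} {Q : Kernel 𝓧 𝓧} [IsMarkovKernel Q]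

/-- The filtration of the pasts `past X n`, `n ≥ 0`. -/
def pastFiltration (X : ℤ → Ω → 𝓧) (hX : ∀ k, Measurable (X k)) :
    Filtration ℕ ‹MeasurableSpace Ω› where
  seq n := past X n
  mono' _ _ hmn := iSup₂_le fun k hk =>
    le_iSup₂_of_le k (hk.trans (by exact_mod_cast hmn)) le_rfl
  le' _ := iSup₂_le fun k _ => (hX k).comap_le

lemma IsStationaryErgodicMarkovChain.isMarkovChain
    (hX : IsStationaryErgodicMarkovChain P X Q) :
    IsMarkovChain Q P (pastFiltration X hX.measurable) (fun n ω => X n ω) where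
  adapted n := by
    refine Measurable.mono (comap_measurable (X n)) ?_ le_rfl
    exact le_iSup₂_of_le (f := fun (k : ℤ) (_ : k ≤ (n : ℤ)) =>
      MeasurableSpace.comap (X k) inferInstance) (n : ℤ) le_rfl le_rfl
  step n A hA B hB := by
    have hle : past X n ≤ ‹MeasurableSpace Ω› := (pastFiltration X hX.measurable).le n
    have hB' : MeasurableSet (X ((n : ℤ) + 1) ⁻¹' B) := hX.measurable _ hB
    have hi : Integrable ((X ((n : ℤ) + 1) ⁻¹' B).indicator fun _ => (1 : ℝ)) P :=
      (integrable_const _).indicator hB'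
    have h1 := setIntegral_condExp (m := past X n) hle hi hA
    rw [setIntegral_congr_ae (hle _ hA) ((hX.markov n B hB).mono fun ω h _ => h),
      integral_indicator hB', setIntegral_const, measureReal_restrict_apply hB'] at h1
    have hm : Measurable fun ω => Q (X n ω) B := (Q.measurable_coe hB).comp (hX.measurable n)
    have h2 : ∫ ω in A, (Q (X n ω)).real B ∂P = (∫⁻ ω in A, Q (X n ω) B ∂P).toReal :=
      integral_toReal hm.aemeasurable (ae_of_all _ fun ω => measure_lt_top _ _)
    have h3 : ∫⁻ ω in A, Q (X n ω) B ∂P ≠ ∞ := by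
      refine ne_top_of_le_ne_top (measure_ne_top P A) ?_
      calc ∫⁻ ω in A, Q (X n ω) B ∂P ≤ ∫⁻ ω in A, 1 ∂P :=
            lintegral_mono fun ω => prob_le_one
        _ = P A := by simp
    rw [h2, smul_eq_mul, mul_one] at h1
    have h4 := (ENNReal.toReal_eq_toReal_iff' h3 (measure_ne_top _ _)).1 h1
    rw [h4, Set.inter_comm]
    norm_cast

omit [IsProbabilityMeasure P] [IsMarkovKernel Q] in
lemma IsStationaryErgodicMarkovChain.map_eq (hX : IsStationaryErgodicMarkovChain P X Q)
    (n : ℕ) : P.map (X n) = P.map (X 0) := by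
  have hpath : Measurable fun ω k => X k ω := measurable_pi_lambda _ hX.measurable
  have hs := hX.ergodic.toMeasurePreserving
  induction n with
  | zero => rfl
  | succ n ih =>
    rw [← ih]
    have h1 := congrArg (fun ν => ν.map (fun x : ℤ → 𝓧 => x n)) hs.map_eq
    rw [Measure.map_map (measurable_pi_apply _) hs.measurable,
      Measure.map_map ((measurable_pi_apply _).comp hs.measurable) hpath,
      Measure.map_map (measurable_pi_apply _) hpath] at h1
    exact_mod_cast h1

lemma IsStationaryErgodicMarkovChain.invariant (hX : IsStationaryErgodicMarkovChain P X Q) :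
    Q.Invariant (P.map (X 0)) := by
  have h := hX.isMarkovChain.map_add 0 1
  rw [pow_one] at h
  have h1 : P.map (X ((0 + 1 : ℕ) : ℤ)) = P.map (X 0) := hX.map_eq _
  exact h.symm.trans h1

end Stationary

/-! ### Maximal inequality for the partial sums -/

section MaximalInequality

variable {Ω 𝓧 : Type*} {m0 : MeasurableSpace Ω} [MeasurableSpace 𝓧]
  {Q : Kernel 𝓧 𝓧} [IsMarkovKernel Q] {g : 𝓧 → ℝ}
  {μ : Measure Ω} [IsProbabilityMeasure μ] {ℱ : Filtration ℕ m0} {Y : ℕ → Ω → 𝓧}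

/-- The part of `g` exceeding `K` in absolute value. -/
def exceeding (g : 𝓧 → ℝ) (K : ℝ) : 𝓧 → ℝ := {x | K < |g x|}.indicator g

lemma measurable_exceeding (hg : Measurable g) (K : ℝ) : Measurable (exceeding g K) :=
  hg.indicator (measurableSet_lt measurable_const hg.abs)

omit [MeasurableSpace 𝓧] in
lemma abs_le_add_exceeding (K : ℝ) (hK : 0 ≤ K) (x : 𝓧) : |g x| ≤ K + |exceeding g K x| := by
  by_cases h : K < |g x|
  · simp [exceeding, Set.indicator_of_mem (s := {x | K < |g x|}) h, hK]
  · have : exceeding g K x = 0 := Set.indicator_of_notMem (s := {x | K < |g x|}) h g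
    rw [this, abs_zero, add_zero]
    exact not_lt.1 h

/-- Maximal inequality for the partial sums of a function of a Markov chain: blocks of length
`2 ^ s` are split into a martingale part and a part handled by dyadic chaining. -/
theorem IsMarkovChain.exists_majorant_blockSum (h : IsMarkovChain Q μ ℱ Y) (hg : Measurable g)
    (hY2 : ∀ k, MemLp (fun ω => g (Y k ω)) 2 μ) {s N : ℕ} (hsN : s ≤ N) {R ε δ : ℝ≥0∞}
    {c : ℕ → ℝ≥0∞} {K : ℝ} (hK : 0 ≤ K)
    (hc : ∀ i, s ≤ i → i ≤ N → ∑ j ∈ Finset.range (2 ^ (N - i)),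
      ∫⁻ ω, ‖condMean Q g i (Y (j * 2 ^ i) ω)‖ₑ ^ 2 ∂μ ≤ (R * c i) ^ 2)
    (hv : ∑ j ∈ Finset.range (2 ^ (N - s)),
      ∫⁻ ω, ‖blockSum g Y (j * 2 ^ s) (2 ^ s) ω‖ₑ ^ 2 ∂μ ≤ (R * ε) ^ 2)
    (ht : ∑ l ∈ Finset.range (2 ^ N + 1), ∫⁻ ω, ‖exceeding g K (Y l ω)‖ₑ ^ 2 ∂μ ≤ (R * δ) ^ 2) :
    ∃ G : Ω → ℝ, AEStronglyMeasurable G μ ∧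
      (∀ᵐ ω ∂μ, ∀ k ≤ 2 ^ N, |blockSum g Y 0 k ω| ≤ G ω) ∧
      eLpNorm G 2 μ ≤ R * (5 * ∑ i ∈ Finset.range (N - s + 1), c (s + i) + 4 * ε + 2 ^ s * δ) +
        2 ^ s * ENNReal.ofReal K := by
  have hpow : 2 ^ (N - s) * 2 ^ s = 2 ^ N := by rw [← pow_add, Nat.sub_add_cancel hsN]
  -- the chaining part
  have hem : ∀ i j, StronglyMeasurable[ℱ (j * 2 ^ i)]
      (fun ω => condMean Q g i (Y (j * 2 ^ i) ω)) := fun i j =>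
    ((measurable_condMean hg i).comp (h.adapted _)).stronglyMeasurable
  -- The pairing relation required by the chaining is the Markov property over 2^i steps.
  have he : ∀ i j, (fun ω => condMean Q g (i + 1) (Y (j * 2 ^ (i + 1)) ω)) =ᵐ[μ]
      (fun ω => condMean Q g i (Y (2 * j * 2 ^ i) ω)) +
        μ[fun ω => condMean Q g i (Y ((2 * j + 1) * 2 ^ i) ω) | ℱ (j * 2 ^ (i + 1))] :=
    fun i j => by
      have h1 : (2 * j + 1) * 2 ^ i = j * 2 ^ (i + 1) + 2 ^ i := by ring
      have h2 : 2 * j * 2 ^ i = j * 2 ^ (i + 1) := by ring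
      rw [h1, h2]
      filter_upwards [h.condExp_add (measurable_condMean hg i) (n := j * 2 ^ (i + 1)) (m := 2 ^ i)
        ((h.memLp_condMean hg hY2 i _).integrable one_le_two)] with ω hω
      rw [Pi.add_apply, hω]
      rfl
  obtain ⟨G₁, hG₁, hb₁, hn₁⟩ := exists_majorant_dyadic ℱ hem
    (fun i j => h.memLp_condMean hg hY2 i _) he (N - s) s (fun i => R * c (s + i))
    fun i hi => by
      have := hc (s + i) (Nat.le_add_right _ _) (by omega)
      rwa [show N - (s + i) = N - s - i by omega] at this
  -- the martingale part
  set D : ℕ → Ω → ℝ := fun j => blockSum g Y (j * 2 ^ s) (2 ^ s) -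
    μ[blockSum g Y (j * 2 ^ s) (2 ^ s) | ℱ (j * 2 ^ s)] with hD
  have hBm : ∀ j, StronglyMeasurable[ℱ ((j + 1) * 2 ^ s)]
      (blockSum g Y (j * 2 ^ s) (2 ^ s)) := fun j => by
    refine Finset.stronglyMeasurable_fun_sum _ fun l hl => ?_
    refine ((hg.comp (h.adapted _)).stronglyMeasurable).mono (ℱ.mono ?_)
    have := Finset.mem_range.1 hl
    rw [add_mul, one_mul]
    omega
  obtain ⟨G₂, hG₂, hb₂, hn₂⟩ := exists_majorant_martingale (sampled ℱ (2 ^ s)) (D := D)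
    (fun j => (hBm j).sub (stronglyMeasurable_condExp.mono
      (ℱ.mono (Nat.mul_le_mul_right _ j.le_succ))))
    (fun j => (memLp_blockSum hY2 _ _).sub ((memLp_blockSum hY2 _ _).condExp one_le_two))
    (fun j => condExp_sub_condExp_ae_eq_zero (ℱ.le _)
      ((memLp_blockSum hY2 _ _).integrable one_le_two)) (2 ^ (N - s))
  have hn₂' : eLpNorm G₂ 2 μ ≤ R * (4 * ε) := by
    refine eLpNorm_two_le_of_sq_le (hn₂.trans ?_)
    calc 4 * ∑ j ∈ Finset.range (2 ^ (N - s)), ∫⁻ ω, ‖D j ω‖ₑ ^ 2 ∂μ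
        ≤ 4 * ∑ j ∈ Finset.range (2 ^ (N - s)),
            4 * ∫⁻ ω, ‖blockSum g Y (j * 2 ^ s) (2 ^ s) ω‖ₑ ^ 2 ∂μ := by
          gcongr with j
          exact lintegral_enorm_sub_condExp_sq_le (memLp_blockSum hY2 _ _).1
      _ ≤ 4 * (4 * (R * ε) ^ 2) := by
          rw [← Finset.mul_sum]
          gcongr
      _ = (R * (4 * ε)) ^ 2 := by ring
  -- the part inside a block
  obtain ⟨G₃, hG₃, hb₃, hn₃⟩ := exists_majorant_sqrt_sum (μ := μ)
    (fun l => (measurable_exceeding hg K).comp (h.measurable l)) (2 ^ N + 1)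
  have hn₃' : eLpNorm (fun ω => 2 ^ s * (K + G₃ ω)) 2 μ ≤
      2 ^ s * (ENNReal.ofReal K + R * δ) := by
    have hsmul : (fun ω => 2 ^ s * (K + G₃ ω)) = ((2 : ℝ) ^ s) • ((fun _ => K) + G₃) := by
      ext ω
      simp
    rw [hsmul]
    calc eLpNorm (((2 : ℝ) ^ s) • ((fun _ => K) + G₃)) 2 μ
        = ‖(2 : ℝ) ^ s‖ₑ * eLpNorm ((fun _ => K) + G₃) 2 μ := eLpNorm_const_smul _ _ _ _
      _ ≤ 2 ^ s * (eLpNorm (fun _ : Ω => K) 2 μ + eLpNorm G₃ 2 μ) := by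
          gcongr
          · rw [Real.enorm_eq_ofReal (by positivity), ENNReal.ofReal_pow (by norm_num)]
            norm_num
          · exact eLpNorm_add_le aestronglyMeasurable_const hG₃.aestronglyMeasurable one_le_two
      _ ≤ 2 ^ s * (ENNReal.ofReal K + R * δ) := by
          gcongr
          · rw [eLpNorm_const _ two_ne_zero (IsProbabilityMeasure.ne_zero μ)]
            simp [Real.enorm_eq_ofReal hK]
          · exact eLpNorm_two_le_of_sq_le (hn₃.trans_le ht)
  have hG₃m : AEStronglyMeasurable (fun ω => 2 ^ s * (K + G₃ ω)) μ :=
    ((hG₃.const_add K).const_mul _).aestronglyMeasurable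
  refine ⟨G₁ + G₂ + fun ω => 2 ^ s * (K + G₃ ω), (hG₁.1.add hG₂.1).add hG₃m, ?_, ?_⟩
  · filter_upwards [hb₁, ae_all_iff.2 fun j => h.condExp_blockSum hg hY2 s (j * 2 ^ s)]
      with ω h1 h2 k hk
    have hk2 : k / 2 ^ s ≤ 2 ^ (N - s) := by
      refine Nat.div_le_of_le_mul ?_
      rwa [mul_comm, hpow]
    -- The complete blocks split into conditional mean plus centred part; the last k mod 2^s terms
    -- are left over.
    have hsplit : blockSum g Y 0 k ω =
        ∑ j ∈ Finset.range (k / 2 ^ s), condMean Q g s (Y (j * 2 ^ s) ω) +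
        ∑ j ∈ Finset.range (k / 2 ^ s), D j ω +
        blockSum g Y (k / 2 ^ s * 2 ^ s) (k % 2 ^ s) ω := by
      conv_lhs => rw [← Nat.div_add_mod' k (2 ^ s), blockSum_add, blockSum_mul, Nat.zero_add]
      congr 1
      rw [← Finset.sum_add_distrib]
      refine Finset.sum_congr rfl fun j _ => ?_
      simp only [hD, Pi.sub_apply, h2 j]
      ring
    have hin : |blockSum g Y (k / 2 ^ s * 2 ^ s) (k % 2 ^ s) ω| ≤ 2 ^ s * (K + G₃ ω) := by
      have hterm : ∀ l < k % 2 ^ s, |g (Y (k / 2 ^ s * 2 ^ s + 1 + l) ω)| ≤ K + G₃ ω :=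
        fun l hl => by
          have hd := Nat.div_add_mod' k (2 ^ s)
          have hlt : k / 2 ^ s * 2 ^ s + 1 + l < 2 ^ N + 1 := by omega
          have := hb₃ ω _ hlt
          have h3 := abs_le_add_exceeding (g := g) K hK (Y (k / 2 ^ s * 2 ^ s + 1 + l) ω)
          simp only [Function.comp_apply] at this
          linarith
      have hpos : 0 ≤ K + G₃ ω := add_nonneg hK ((abs_nonneg _).trans (hb₃ ω 0 (by positivity)))
      calc |blockSum g Y (k / 2 ^ s * 2 ^ s) (k % 2 ^ s) ω|
          ≤ ∑ l ∈ Finset.range (k % 2 ^ s), |g (Y (k / 2 ^ s * 2 ^ s + 1 + l) ω)| :=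
            Finset.abs_sum_le_sum_abs _ _
        _ ≤ ∑ l ∈ Finset.range (k % 2 ^ s), (K + G₃ ω) :=
            Finset.sum_le_sum fun l hl => hterm l (Finset.mem_range.1 hl)
        _ = (k % 2 ^ s : ℕ) * (K + G₃ ω) := by
            rw [Finset.sum_const, Finset.card_range, nsmul_eq_mul]
        _ ≤ 2 ^ s * (K + G₃ ω) := by
            gcongr
            exact_mod_cast (Nat.mod_lt k (by positivity)).le
    have h3 := h1 _ hk2
    have h4 := hb₂ ω _ hk2
    rw [hsplit]
    simp only [Pi.add_apply]
    refine (abs_add_le _ _).trans (add_le_add ((abs_add_le _ _).trans (add_le_add h3 h4)) hin)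
  · calc eLpNorm (G₁ + G₂ + fun ω => 2 ^ s * (K + G₃ ω)) 2 μ
        ≤ eLpNorm G₁ 2 μ + eLpNorm G₂ 2 μ + eLpNorm (fun ω => 2 ^ s * (K + G₃ ω)) 2 μ :=
          (eLpNorm_add_le (hG₁.add hG₂).1 hG₃m one_le_two).trans
            (by gcongr; exact eLpNorm_add_le hG₁.1 hG₂.1 one_le_two)
      _ ≤ 5 * ∑ i ∈ Finset.range (N - s + 1), R * c (s + i) + R * (4 * ε) +
            2 ^ s * (ENNReal.ofReal K + R * δ) := by
          gcongr
      _ = _ := by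
          rw [← Finset.mul_sum]
          ring

end MaximalInequality

/-! ### Almost everywhere bounds from Hopf's inequality -/

section AlmostEverywhere

variable {𝓧 : Type*} [MeasurableSpace 𝓧] {p : Measure 𝓧}
  {K : ℕ → Kernel 𝓧 𝓧} [∀ i, IsMarkovKernel (K i)] {d : ℕ → 𝓧 → ℝ≥0∞} {lam : ℕ → ℝ≥0∞}

lemma measure_exists_lt_sum_le (hK : ∀ i, (K i).Invariant p) (hd : ∀ i, Measurable (d i))
    (h0 : ∀ i, lam i ≠ 0) (htop : ∀ i, lam i ≠ ∞) (i : ℕ) :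
    p {x | ∃ k : ℕ, k * lam i < ∑ j ∈ Finset.range k, ∫⁻ z, d i z ∂((K i ^ j) x)} ≤
      (∫⁻ x, d i x ∂p) / lam i := by
  rw [ENNReal.le_div_iff_mul_le (Or.inl (h0 i)) (Or.inl (htop i)), mul_comm]
  exact mul_measure_exists_lt_sum_le (hK i) (hd i) (lam i)

/-- Borel–Cantelli applied to the exceptional sets of Hopf's inequality. -/
theorem ae_eventually_sum_le (hK : ∀ i, (K i).Invariant p) (hd : ∀ i, Measurable (d i))
    (h0 : ∀ i, lam i ≠ 0) (htop : ∀ i, lam i ≠ ∞)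
    (hsum : ∑' i, (∫⁻ x, d i x ∂p) / lam i ≠ ∞) :
    ∀ᵐ x ∂p, ∀ᶠ i in atTop, ∀ k : ℕ,
      ∑ j ∈ Finset.range k, ∫⁻ z, d i z ∂((K i ^ j) x) ≤ k * lam i := by
  have := ae_eventually_notMem (ne_top_of_le_ne_top hsum
    (ENNReal.tsum_le_tsum (measure_exists_lt_sum_le hK hd h0 htop)))
  filter_upwards [this] with x hx
  filter_upwards [hx] with i hi k
  by_contra hlt
  exact hi ⟨k, not_le.1 hlt⟩

/-- Without summability: the points that are exceptional for every i ≥ a lie in sets of arbitrarily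
small measure, so they form a null set. -/
theorem ae_frequently_sum_le (hK : ∀ i, (K i).Invariant p) (hd : ∀ i, Measurable (d i))
    (h0 : ∀ i, lam i ≠ 0) (htop : ∀ i, lam i ≠ ∞)
    (hlim : Tendsto (fun i => (∫⁻ x, d i x ∂p) / lam i) atTop (𝓝 0)) :
    ∀ᵐ x ∂p, ∃ᶠ i in atTop, ∀ k : ℕ,
      ∑ j ∈ Finset.range k, ∫⁻ z, d i z ∂((K i ^ j) x) ≤ k * lam i := by
  simp_rw [frequently_atTop]
  refine ae_all_iff.2 fun a => ?_
  rw [ae_iff]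
  refine le_antisymm (ge_of_tendsto hlim ?_) zero_le
  filter_upwards [eventually_ge_atTop a] with i hi
  refine (measure_mono fun x hx => ?_).trans (measure_exists_lt_sum_le hK hd h0 htop i)
  simp only [Set.mem_ofPred_eq, not_exists, not_and] at hx
  have := hx i hi
  push Not at this
  exact this

end AlmostEverywhere

/-! ### Moments under the laws P^x -/

section PathLaw

variable {𝓧 : Type*} [MeasurableSpace 𝓧] {Q : Kernel 𝓧 𝓧} [IsMarkovKernel Q] {g : 𝓧 → ℝ}

lemma map_pathLaw (x : 𝓧) (n : ℕ) : (pathLaw Q x).map (fun y => y n) = (Q ^ n) x := by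
  have h := (isMarkovChain_pathLaw Q x).map_add 0 n
  rw [map_zero_pathLaw, Measure.dirac_bind (Kernel.measurable _), Nat.zero_add] at h
  exact h

lemma lintegral_pathLaw (x : 𝓧) (n : ℕ) {f : 𝓧 → ℝ≥0∞} (hf : Measurable f) :
    ∫⁻ y, f (y n) ∂(pathLaw Q x) = ∫⁻ z, f z ∂((Q ^ n) x) := by
  rw [← map_pathLaw, lintegral_map hf (measurable_pi_apply n)]

/-- `x ↦ E^x(S_n²)`. -/
def sqMean (Q : Kernel 𝓧 𝓧) [IsMarkovKernel Q] (g : 𝓧 → ℝ) (n : ℕ) (x : 𝓧) : ℝ≥0∞ :=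
  ∫⁻ y, ‖partialSum g n y‖ₑ ^ 2 ∂(pathLaw Q x)

lemma measurable_partialSum (hg : Measurable g) (n : ℕ) : Measurable (partialSum g n) := by
  unfold partialSum
  fun_prop

lemma measurable_maxAbsPartialSum (hg : Measurable g) (n : ℕ) :
    Measurable (maxAbsPartialSum g n) := by
  unfold maxAbsPartialSum
  refine Finset.measurable_range_sup'' fun k _ => ?_
  exact (measurable_partialSum hg k).abs

lemma measurable_sqMean (hg : Measurable g) (n : ℕ) : Measurable (sqMean Q g n) :=
  ((measurable_partialSum hg n).enorm.pow_const 2).lintegral_kernel (κ := pathKernel Q)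

lemma ae_memLp_pathLaw {p : Measure 𝓧} (hQ : Q.Invariant p) (hg : Measurable g)
    (hg2 : MemLp g 2 p) : ∀ᵐ x ∂p, ∀ k, MemLp (fun y => g (y k)) 2 (pathLaw Q x) := by
  refine ae_all_iff.2 fun k => ?_
  have hm : Measurable fun x => ‖g x‖ₑ ^ 2 := hg.enorm.pow_const 2
  have h1 : ∫⁻ x, ∫⁻ z, ‖g z‖ₑ ^ 2 ∂((Q ^ k) x) ∂p ≠ ∞ := by
    rw [lintegral_invariant (invariant_pow hQ k) hm, lintegral_enorm_sq_eq_ofReal hg2]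
    exact ENNReal.ofReal_ne_top
  filter_upwards [ae_lt_top (hm.lintegral_kernel (κ := Q ^ k)) h1] with x hx
  refine memLp_two_of_lintegral (hg.comp (measurable_pi_apply k)).aestronglyMeasurable ?_
  rw [lintegral_pathLaw x k hm]
  exact hx.ne

end PathLaw

/-! ### Stationary moments and the summability of the dyadic levels -/

section Moments

variable {Ω 𝓧 : Type*} [MeasurableSpace Ω] [MeasurableSpace 𝓧]
  {P : Measure Ω} [IsProbabilityMeasure P] {X : ℤ → Ω → 𝓧} {Q : Kernel 𝓧 𝓧} [IsMarkovKernel Q]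
  {g : 𝓧 → ℝ}

namespace IsStationaryErgodicMarkovChain

omit [IsProbabilityMeasure P] [IsMarkovKernel Q] in
lemma memLp (hX : IsStationaryErgodicMarkovChain P X Q) (hg : Measurable g)
    (hg2 : MemLp g 2 (P.map (X 0))) (k : ℕ) : MemLp (fun ω => g (X k ω)) 2 P := by
  rw [← hX.map_eq k] at hg2
  exact (memLp_map_measure_iff hg.aestronglyMeasurable (hX.measurable k).aemeasurable).1 hg2

lemma lintegral_sqMean (hX : IsStationaryErgodicMarkovChain P X Q) (hg : Measurable g)
    (hg2 : MemLp g 2 (P.map (X 0))) (n : ℕ) :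
    ∫⁻ x, sqMean Q g n x ∂(P.map (X 0)) = ENNReal.ofReal (sumVariance P X g n) := by
  have h := hX.isMarkovChain.lintegral_blockSum hg 0 n
  have h1 := lintegral_enorm_sq_eq_ofReal
    (memLp_blockSum (Y := fun (n : ℕ) ω => X n ω) (hX.memLp hg hg2) 0 n)
  rw [h] at h1
  refine h1.trans ?_
  congr 1
  refine integral_congr_ae (ae_of_all _ fun ω => ?_)
  simp only
  rw [← partialSum_eq_blockSum]
  rfl

/-- Conditioning on the whole past gives a function of X_0, by the Markov property, so conditioning
on X_0 alone gives the same function. -/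
lemma lintegral_condMean (hX : IsStationaryErgodicMarkovChain P X Q) (hg : Measurable g)
    (hg2 : MemLp g 2 (P.map (X 0))) (i : ℕ) :
    ∫⁻ x, ‖condMean Q g i x‖ₑ ^ 2 ∂(P.map (X 0)) =
      ENNReal.ofReal (condSumNorm P X g (2 ^ i) ^ 2) := by
  have hM := hX.isMarkovChain
  have hY2 := hX.memLp hg hg2
  have hS : (fun ω => partialSum g (2 ^ i) (forward X ω)) =
      blockSum g (fun (n : ℕ) ω => X n ω) 0 (2 ^ i) := by
    ext ω
    rw [← partialSum_eq_blockSum]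
    rfl
  have hle : MeasurableSpace.comap (X 0) inferInstance ≤ pastFiltration X hX.measurable 0 :=
    le_iSup₂_of_le (f := fun (k : ℤ) (_ : k ≤ ((0 : ℕ) : ℤ)) =>
      MeasurableSpace.comap (X k) inferInstance) 0 (by simp) le_rfl
  have hm : StronglyMeasurable[MeasurableSpace.comap (X 0) inferInstance]
      (fun ω => condMean Q g i (X 0 ω)) :=
    ((measurable_condMean hg i).comp (comap_measurable (X 0))).stronglyMeasurable
  have h1 := hM.condExp_blockSum hg hY2 i 0
  have h2 : P[fun ω => partialSum g (2 ^ i) (forward X ω) |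
      MeasurableSpace.comap (X 0) inferInstance] =ᵐ[P] fun ω => condMean Q g i (X 0 ω) := by
    rw [hS]
    refine (condExp_condExp_of_le hle ((pastFiltration X hX.measurable).le 0)).symm.trans ?_
    refine (condExp_congr_ae h1).trans ?_
    exact (condExp_of_stronglyMeasurable (hX.measurable 0).comap_le hm
      (integrable_condExp.congr h1)).eventuallyEq
  have h3 : MemLp (fun ω => condMean Q g i (X 0 ω)) 2 P := hM.memLp_condMean hg hY2 i 0
  rw [condSumNorm, eLpNorm_congr_ae h2, lintegral_map
    ((measurable_condMean hg i).enorm.pow_const 2) (hX.measurable 0), ← eLpNorm_two_sq,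
    ENNReal.ofReal_pow ENNReal.toReal_nonneg, ENNReal.ofReal_toReal h3.2.ne]

end IsStationaryErgodicMarkovChain

/-- The summable weights used along the dyadic levels. -/
def levelWeight (i : ℕ) : ℝ := ((i + 1 : ℕ) : ℝ) ^ (-(5 / 4) : ℝ)

lemma levelWeight_pos (i : ℕ) : 0 < levelWeight i :=
  Real.rpow_pos_of_pos (by positivity) _

lemma tsum_levelWeight_ne_top : ∑' i, ENNReal.ofReal (levelWeight i) ≠ ∞ := by
  refine Summable.tsum_ofReal_ne_top ?_
  exact (summable_nat_add_iff 1).2 (Real.summable_nat_rpow.2 (by norm_num))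

lemma levelWeight_sq (i : ℕ) : levelWeight i ^ 2 = ((i + 1 : ℕ) : ℝ) ^ (-(5 / 2) : ℝ) := by
  rw [levelWeight, ← Real.rpow_natCast, ← Real.rpow_mul (by positivity)]
  norm_num

/-- With t = i + 1, the rate for q ≥ 2 gives a(2^i)²/2^i = O(t^{-4}), and division by w_i² =
t^{-5/2} leaves t^{-3/2}. The exponent 5/4 thus keeps both the weights and these ratios summable. -/
lemma summable_sq_div_levelWeight {a : ℕ → ℝ} (ha : ∀ n, 0 ≤ a n) {q : ℝ} (hq : 2 ≤ q)
    (h : a =o[atTop] fun n : ℕ => √(n : ℝ) * (Real.log n) ^ (-q)) :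
    Summable fun i : ℕ => a (2 ^ i) ^ 2 / (2 ^ i * levelWeight i ^ 2) := by
  have hpow : Tendsto (fun i : ℕ => 2 ^ i) atTop atTop :=
    tendsto_pow_atTop_atTop_of_one_lt (by norm_num)
  have hs : Summable fun i : ℕ => 256 * ((i + 1 : ℕ) : ℝ) ^ (-(3 / 2) : ℝ) :=
    ((summable_nat_add_iff 1).2 (Real.summable_nat_rpow.2 (by norm_num))).mul_left 256
  refine hs.of_norm_bounded_eventually_nat ?_
  filter_upwards [hpow.eventually (h.bound one_pos), eventually_ge_atTop 2] with i hi h2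
  have hi2 : (2 : ℝ) ≤ i := by exact_mod_cast h2
  set t : ℝ := ((i + 1 : ℕ) : ℝ) with ht
  have ht' : t = i + 1 := by simp [ht]
  have htpos : 0 < t := by positivity
  have hlog2 : 1 / 2 ≤ Real.log 2 := by linarith [Real.log_two_gt_d9]
  have hlog : Real.log ((2 ^ i : ℕ) : ℝ) = i * Real.log 2 := by
    push_cast
    rw [Real.log_pow]
  -- Uses i ≥ 2 and log 2 ≥ 1/2. The bound `hL1` allows -q to be replaced by -2; squaring 16 = 4²
  -- gives the constant 256.
  have hL : t / 4 ≤ i * Real.log 2 := by nlinarith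
  have hL1 : 1 ≤ i * Real.log 2 := by nlinarith
  have hLq : (i * Real.log 2) ^ (-q) ≤ 16 / t ^ 2 := by
    calc (i * Real.log 2) ^ (-q) ≤ (i * Real.log 2) ^ (-2 : ℝ) :=
          Real.rpow_le_rpow_of_exponent_le hL1 (by linarith)
      _ = ((i * Real.log 2) ^ 2)⁻¹ := by
          rw [Real.rpow_neg (by linarith)]
          norm_cast
      _ ≤ ((t / 4) ^ 2)⁻¹ := by gcongr
      _ = 16 / t ^ 2 := by
          field_simp
          norm_num
  have hai : a (2 ^ i) ≤ √((2 ^ i : ℕ) : ℝ) * (16 / t ^ 2) := by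
    rw [one_mul, hlog, Real.norm_of_nonneg (ha _), Real.norm_of_nonneg (by positivity)] at hi
    exact hi.trans (by gcongr)
  have hai2 : a (2 ^ i) ^ 2 ≤ 2 ^ i * (256 / t ^ 4) := by
    calc a (2 ^ i) ^ 2 ≤ (√((2 ^ i : ℕ) : ℝ) * (16 / t ^ 2)) ^ 2 :=
          pow_le_pow_left₀ (ha _) hai 2
      _ = 2 ^ i * (256 / t ^ 4) := by
          rw [mul_pow, Real.sq_sqrt (by positivity)]
          push_cast
          field_simp
          norm_num
  have hw := levelWeight_pos i
  rw [Real.norm_of_nonneg (by positivity), div_le_iff₀ (by positivity), levelWeight_sq, ← ht]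
  refine hai2.trans (le_of_eq ?_)
  have : t ^ (-(3 / 2) : ℝ) * t ^ (-(5 / 2) : ℝ) = (t ^ 4)⁻¹ := by
    rw [← Real.rpow_add htpos, show (-(3 / 2) + -(5 / 2) : ℝ) = -(4 : ℕ) by norm_num,
      Real.rpow_neg htpos.le, Real.rpow_natCast]
  calc (2 : ℝ) ^ i * (256 / t ^ 4) = 256 * 2 ^ i * (t ^ 4)⁻¹ := by ring
    _ = _ := by
      rw [← this]
      ring

end Moments

/-! ### The majorant under almost every P^x -/

section Quenched

variable {Ω 𝓧 : Type*} [MeasurableSpace Ω] [MeasurableSpace 𝓧]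
  {P : Measure Ω} [IsProbabilityMeasure P] {X : ℤ → Ω → 𝓧} {Q : Kernel 𝓧 𝓧} [IsMarkovKernel Q]
  {g : 𝓧 → ℝ}

lemma tendsto_lintegral_exceeding {p : Measure 𝓧} (hg : Measurable g) (hg2 : MemLp g 2 p) :
    Tendsto (fun n : ℕ => ∫⁻ x, ‖exceeding g n x‖ₑ ^ 2 ∂p) atTop (𝓝 0) := by
  have hfin : ∫⁻ x, ‖g x‖ₑ ^ 2 ∂p ≠ ∞ := by
    rw [lintegral_enorm_sq_eq_ofReal hg2]
    exact ENNReal.ofReal_ne_top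
  rw [← lintegral_zero (μ := p)]
  refine tendsto_lintegral_of_dominated_convergence (fun x => ‖g x‖ₑ ^ 2)
    (fun n => (measurable_exceeding hg n).enorm.pow_const 2) (fun n => ae_of_all _ fun x => ?_)
    hfin (ae_of_all _ fun x => ?_)
  · simp only
    gcongr
    exact enorm_indicator_le_enorm_self g x
  · refine tendsto_const_nhds.congr' ?_
    obtain ⟨n, hn⟩ := exists_nat_ge |g x|
    filter_upwards [eventually_ge_atTop n] with k hk
    have : x ∉ {x | (k : ℝ) < |g x|} := not_lt.2 (hn.trans (by exact_mod_cast hk))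
    rw [exceeding, Set.indicator_of_notMem this]
    simp

namespace IsStationaryErgodicMarkovChain

theorem ae_eventually_sum_condMean_le (hX : IsStationaryErgodicMarkovChain P X Q)
    (hg : Measurable g) (hg2 : MemLp g 2 (P.map (X 0))) {q : ℝ} (hq : 2 ≤ q)
    (h : (fun n : ℕ => condSumNorm P X g n)
      =o[atTop] fun n : ℕ => √(n : ℝ) * (Real.log n) ^ (-q)) :
    ∀ᵐ x ∂(P.map (X 0)), ∀ᶠ i in atTop, ∀ k : ℕ,
      ∑ j ∈ Finset.range k, ∫⁻ z, ‖condMean Q g i z‖ₑ ^ 2 ∂(((Q ^ 2 ^ i) ^ j) x) ≤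
        k * (2 ^ i * ENNReal.ofReal (levelWeight i) ^ 2) := by
  have hlam : ∀ i, (2 : ℝ≥0∞) ^ i * ENNReal.ofReal (levelWeight i) ^ 2 =
      ENNReal.ofReal (2 ^ i * levelWeight i ^ 2) := fun i => by
    rw [ENNReal.ofReal_mul (by positivity), ENNReal.ofReal_pow (by norm_num),
      ENNReal.ofReal_pow (levelWeight_pos i).le]
    norm_num
  have hpos : ∀ i, 0 < (2 : ℝ) ^ i * levelWeight i ^ 2 := fun i => by
    have := levelWeight_pos i
    positivity
  simp_rw [hlam]
  refine ae_eventually_sum_le (fun i => invariant_pow hX.invariant _)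
    (fun i => (measurable_condMean hg i).enorm.pow_const 2)
    (fun i => (ENNReal.ofReal_pos.2 (hpos i)).ne') (fun i => ENNReal.ofReal_ne_top) ?_
  simp_rw [hX.lintegral_condMean hg hg2, ← ENNReal.ofReal_div_of_pos (hpos _)]
  exact (summable_sq_div_levelWeight (fun n => ENNReal.toReal_nonneg) hq h).tsum_ofReal_ne_top

theorem ae_frequently_sum_sqMean_le (hX : IsStationaryErgodicMarkovChain P X Q)
    (hg : Measurable g) (hg2 : MemLp g 2 (P.map (X 0)))
    (hσ : Tendsto (fun n : ℕ => sumVariance P X g n / n) atTop (𝓝 0))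
    {ε : ℝ≥0∞} (hε : ε ≠ 0) (hε' : ε ≠ ∞) :
    ∀ᵐ x ∂(P.map (X 0)), ∃ᶠ s in atTop, ∀ k : ℕ,
      ∑ j ∈ Finset.range k, ∫⁻ z, sqMean Q g (2 ^ s) z ∂(((Q ^ 2 ^ s) ^ j) x) ≤
        k * (2 ^ s * ε ^ 2) := by
  have hε2 : ε ^ 2 ≠ 0 := pow_ne_zero 2 hε
  refine ae_frequently_sum_le (fun i => invariant_pow hX.invariant _)
    (fun i => measurable_sqMean hg _) (fun i => mul_ne_zero (by positivity) hε2)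
    (fun i => ENNReal.mul_ne_top (by finiteness) (by finiteness)) ?_
  have h2 : Tendsto (fun s : ℕ => 2 ^ s) atTop atTop :=
    tendsto_pow_atTop_atTop_of_one_lt (by norm_num : 1 < 2)
  have h1 := ENNReal.tendsto_ofReal (hσ.comp h2)
  rw [ENNReal.ofReal_zero] at h1
  have h3 := ENNReal.Tendsto.div_const h1 (Or.inr hε2)
  rw [ENNReal.zero_div] at h3
  refine h3.congr fun s => ?_
  rw [hX.lintegral_sqMean hg hg2, Function.comp_apply, ENNReal.ofReal_div_of_pos (by positivity),
    ENNReal.ofReal_natCast]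
  push_cast
  rw [div_eq_mul_inv, div_eq_mul_inv, div_eq_mul_inv,
    ENNReal.mul_inv (Or.inl (by positivity)) (Or.inl (by finiteness)), mul_assoc]

theorem ae_frequently_sum_exceeding_le (hX : IsStationaryErgodicMarkovChain P X Q)
    (hg : Measurable g) (hg2 : MemLp g 2 (P.map (X 0))) {ε : ℝ≥0∞} (hε : ε ≠ 0) (hε' : ε ≠ ∞) :
    ∀ᵐ x ∂(P.map (X 0)), ∃ᶠ K : ℕ in atTop, ∀ k : ℕ,
      ∑ j ∈ Finset.range k, ∫⁻ z, ‖exceeding g K z‖ₑ ^ 2 ∂((Q ^ j) x) ≤ k * ε ^ 2 := by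
  have hε2 : ε ^ 2 ≠ 0 := pow_ne_zero 2 hε
  refine ae_frequently_sum_le (K := fun _ => Q) (fun i => hX.invariant)
    (fun i => (measurable_exceeding hg i).enorm.pow_const 2) (fun i => hε2)
    (fun i => by finiteness) ?_
  have h3 := ENNReal.Tendsto.div_const (tendsto_lintegral_exceeding hg hg2) (Or.inr hε2)
  rwa [ENNReal.zero_div] at h3

/-- Under almost every `P^x`, the partial sums up to `2 ^ N` are dominated by a random variable
whose `L²` norm is `o(√(2 ^ N))`. -/
theorem ae_eventually_exists_majorant (hX : IsStationaryErgodicMarkovChain P X Q)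
    (hg : Measurable g) (hg2 : MemLp g 2 (P.map (X 0))) {q : ℝ} (hq : 2 ≤ q)
    (h : (fun n : ℕ => condSumNorm P X g n)
      =o[atTop] fun n : ℕ => √(n : ℝ) * (Real.log n) ^ (-q))
    (hσ : Tendsto (fun n : ℕ => sumVariance P X g n / n) atTop (𝓝 0)) :
    ∀ᵐ x ∂(P.map (X 0)), ∀ η : ℝ≥0∞, η ≠ 0 → ∀ᶠ N : ℕ in atTop,
      ∃ G : (ℕ → 𝓧) → ℝ, AEStronglyMeasurable G (pathLaw Q x) ∧
        (∀ᵐ y ∂(pathLaw Q x), ∀ k ≤ 2 ^ N, |partialSum g k y| ≤ G y) ∧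
        eLpNorm G 2 (pathLaw Q x) ≤ ENNReal.ofReal √(2 ^ N) * η := by
  -- Tolerances 1/(m+1) form a countable family, so one null set serves every η.
  have hinv : ∀ m : ℕ, ((m : ℝ≥0∞) + 1)⁻¹ ≠ 0 := fun m =>
    ENNReal.inv_ne_zero.2 (by finiteness)
  have hinv' : ∀ m : ℕ, ((m : ℝ≥0∞) + 1)⁻¹ ≠ ∞ := fun m => by simp
  have hsmall : ∀ η : ℝ≥0∞, η ≠ 0 → ∃ m : ℕ, ((m : ℝ≥0∞) + 1)⁻¹ ≤ η := fun η hη => by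
    obtain ⟨m, hm⟩ := ENNReal.exists_inv_nat_lt hη
    exact ⟨m, (ENNReal.inv_le_inv.2 le_self_add).trans hm.le⟩
  filter_upwards [ae_memLp_pathLaw hX.invariant hg hg2,
    hX.ae_eventually_sum_condMean_le hg hg2 hq h,
    ae_all_iff.2 fun m : ℕ => hX.ae_frequently_sum_sqMean_le hg hg2 hσ (hinv m) (hinv' m),
    ae_all_iff.2 fun m : ℕ => hX.ae_frequently_sum_exceeding_le hg hg2 (hinv m) (hinv' m)]
    with x hY2 hA hB hC η hη
  -- One quarter of η each for chaining, martingale, truncated excess and the level K. The order of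
  -- choice matters: first s, then a tolerance small compared with 2^{-s}, then K, and finally N
  -- large enough to absorb 2^s K.
  have hη4 : η / 4 ≠ 0 := (ENNReal.div_pos hη (by norm_num)).ne'
  obtain ⟨m₁, hm₁⟩ := hsmall (η / 4 / 4) (ENNReal.div_pos hη4 (by norm_num)).ne'
  obtain ⟨i₀, hi₀⟩ := eventually_atTop.1 hA
  have htail := ENNReal.Tendsto.const_mul (a := 5)
    (ENNReal.tendsto_sum_nat_add _ tsum_levelWeight_ne_top) (Or.inr (by norm_num))
  rw [mul_zero] at htail
  obtain ⟨s, hs, hsi, hst⟩ := ((hB m₁).and_eventually ((eventually_ge_atTop i₀).and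
    (htail.eventually_le_const (pos_iff_ne_zero.2 hη4)))).exists
  obtain ⟨m₂, hm₂⟩ := hsmall (η / 4 / (2 ^ s * 2))
    (ENNReal.div_pos hη4 (by finiteness)).ne'
  obtain ⟨K, hK⟩ := (hC m₂).exists
  have hR : Tendsto (fun N : ℕ => ENNReal.ofReal √(2 ^ N) * (η / 4)) atTop (𝓝 ∞) := by
    have h1 : Tendsto (fun N : ℕ => ENNReal.ofReal √(2 ^ N)) atTop (𝓝 ∞) :=
      ENNReal.tendsto_ofReal_atTop.comp
        (Real.tendsto_sqrt_atTop.comp (tendsto_pow_atTop_atTop_of_one_lt (by norm_num)))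
    have h2 := ENNReal.Tendsto.mul_const (b := η / 4) h1 (Or.inl (by simp))
    rwa [ENNReal.top_mul hη4] at h2
  filter_upwards [eventually_ge_atTop s, hR.eventually_const_le
    (show 2 ^ s * ENNReal.ofReal (K : ℝ) < ∞ by finiteness)] with N hsN hN
  have hM := isMarkovChain_pathLaw Q x
  set R := ENNReal.ofReal √(2 ^ N) with hRdef
  have hR2 : R ^ 2 = 2 ^ N := by
    rw [hRdef, ← ENNReal.ofReal_pow (by positivity), Real.sq_sqrt (by positivity),
      ENNReal.ofReal_pow (by norm_num)]
    norm_num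
  have hpow : ∀ i ≤ N, ((2 ^ (N - i) : ℕ) : ℝ≥0∞) * 2 ^ i = R ^ 2 := fun i hi => by
    rw [hR2]
    push_cast
    rw [← pow_add, Nat.sub_add_cancel hi]
  have hQ : ∀ i j, Q ^ (j * 2 ^ i) = (Q ^ 2 ^ i) ^ j := fun i j => by rw [mul_comm, pow_mul]
  obtain ⟨G, hG, hb, hn⟩ := hM.exists_majorant_blockSum hg hY2 hsN (R := R)
    (ε := ((m₁ : ℝ≥0∞) + 1)⁻¹) (δ := 2 * ((m₂ : ℝ≥0∞) + 1)⁻¹)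
    (c := fun i => ENNReal.ofReal (levelWeight i)) (K := K) (Nat.cast_nonneg K)
    (fun i hsi' hiN => by
      have hm : Measurable fun z => ‖condMean Q g i z‖ₑ ^ 2 :=
        (measurable_condMean hg i).enorm.pow_const 2
      calc _ = ∑ j ∈ Finset.range (2 ^ (N - i)),
            ∫⁻ z, ‖condMean Q g i z‖ₑ ^ 2 ∂(((Q ^ 2 ^ i) ^ j) x) := by
            refine Finset.sum_congr rfl fun j _ => ?_
            rw [← hQ]
            exact lintegral_pathLaw x _ hm
        _ ≤ _ := hi₀ i (hsi.trans hsi') _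
        _ = _ := by rw [← mul_assoc, hpow i hiN, mul_pow])
    (by
      calc _ = ∑ j ∈ Finset.range (2 ^ (N - s)),
            ∫⁻ z, sqMean Q g (2 ^ s) z ∂(((Q ^ 2 ^ s) ^ j) x) := by
            refine Finset.sum_congr rfl fun j _ => ?_
            rw [hM.lintegral_blockSum hg, ← hQ, map_pathLaw]
            rfl
        _ ≤ _ := hs _
        _ = _ := by rw [← mul_assoc, hpow s hsN, mul_pow])
    (by
      have hm : Measurable fun z => ‖exceeding g K z‖ₑ ^ 2 :=
        (measurable_exceeding hg K).enorm.pow_const 2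
      calc _ = ∑ j ∈ Finset.range (2 ^ N + 1), ∫⁻ z, ‖exceeding g K z‖ₑ ^ 2 ∂((Q ^ j) x) :=
            Finset.sum_congr rfl fun j _ => lintegral_pathLaw x _ hm
        _ ≤ _ := hK _
        _ ≤ R ^ 2 * 4 * ((m₂ : ℝ≥0∞) + 1)⁻¹ ^ 2 := by
            gcongr
            rw [hR2]
            -- The times 0, …, 2^N number 2^N + 1. The generous bound 4·2^N is a perfect square
            -- multiple of R² and explains the factor 2 in `δ`.
            have : 2 ^ N + 1 ≤ 2 ^ N * 4 := by
              have := Nat.one_le_two_pow (n := N)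
              omega
            exact_mod_cast this
        _ = _ := by ring)
  refine ⟨G, hG, ?_, hn.trans ?_⟩
  · filter_upwards [hb] with y hy k hk
    have := partialSum_eq_blockSum g (fun n (y : ℕ → 𝓧) => y n) k y
    rw [show partialSum g k y = _ from this]
    exact hy k hk
  · have h1 : 5 * ∑ i ∈ Finset.range (N - s + 1), ENNReal.ofReal (levelWeight (s + i)) ≤
        η / 4 := by
      refine le_trans ?_ hst
      gcongr
      simp_rw [add_comm s]
      exact ENNReal.sum_le_tsum _
    have h2 : 4 * ((m₁ : ℝ≥0∞) + 1)⁻¹ ≤ η / 4 :=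
      (mul_le_mul_right hm₁ 4).trans ENNReal.mul_div_le
    have h3 : 2 ^ s * (2 * ((m₂ : ℝ≥0∞) + 1)⁻¹) ≤ η / 4 := by
      rw [← mul_assoc]
      exact (mul_le_mul_right hm₂ _).trans ENNReal.mul_div_le
    calc _ ≤ R * (η / 4 + η / 4 + η / 4) + R * (η / 4) := by gcongr
      _ = R * (4 * (η / 4)) := by ring
      _ = R * η := by rw [ENNReal.mul_div_cancel (by norm_num) (by norm_num)]

end IsStationaryErgodicMarkovChain

end Quenched

/-! ### Passage to the limit, quenched and then averaged -/

section Conclusion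

variable {Ω 𝓧 : Type*} [MeasurableSpace Ω] [MeasurableSpace 𝓧]
  {P : Measure Ω} [IsProbabilityMeasure P] {X : ℤ → Ω → 𝓧} {Q : Kernel 𝓧 𝓧} [IsMarkovKernel Q]
  {g : 𝓧 → ℝ}

namespace IsStationaryErgodicMarkovChain

/-- Chebyshev's inequality for the majorant at the least power 2^N ≥ n; since 2^N ≤ 2n, passing from
n to the dyadic time costs a factor 2. -/
theorem ae_tendsto_pathLaw (hX : IsStationaryErgodicMarkovChain P X Q)
    (hg : Measurable g) (hg2 : MemLp g 2 (P.map (X 0))) {q : ℝ} (hq : 2 ≤ q)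
    (h : (fun n : ℕ => condSumNorm P X g n)
      =o[atTop] fun n : ℕ => √(n : ℝ) * (Real.log n) ^ (-q))
    (hσ : Tendsto (fun n : ℕ => sumVariance P X g n / n) atTop (𝓝 0)) :
    ∀ᵐ x ∂(P.map (X 0)), ∀ ε : ℝ, 0 < ε →
      Tendsto (fun n : ℕ => pathLaw Q x {y | ε * √(n : ℝ) ≤ maxAbsPartialSum g n y})
        atTop (𝓝 0) := by
  filter_upwards [hX.ae_eventually_exists_majorant hg hg2 hq h hσ] with x hx ε hε
  refine ENNReal.tendsto_nhds_zero.2 fun δ hδ => ?_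
  set e := ENNReal.ofReal ε with he
  have he0 : e ≠ 0 := (ENNReal.ofReal_pos.2 hε).ne'
  have hetop : e ≠ ∞ := ENNReal.ofReal_ne_top
  -- `η` with `2 η² ≤ δ e²`
  obtain ⟨η, hη0, hη⟩ : ∃ η : ℝ≥0∞, η ≠ 0 ∧ 2 * η ^ 2 ≤ δ * e ^ 2 := by
    have hcont : Tendsto (fun η : ℝ≥0∞ => 2 * η ^ 2) (𝓝[>] 0) (𝓝 0) := by
      have h1 : Tendsto (fun η : ℝ≥0∞ => 2 * η ^ 2) (𝓝 0) (𝓝 (2 * 0 ^ 2)) :=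
        ENNReal.Tendsto.const_mul (ENNReal.Tendsto.pow tendsto_id) (Or.inr (by norm_num))
      rw [zero_pow two_ne_zero, mul_zero] at h1
      exact h1.mono_left nhdsWithin_le_nhds
    have hpos : 0 < δ * e ^ 2 := ENNReal.mul_pos hδ.ne' (pow_ne_zero 2 he0)
    obtain ⟨η, h1, h2⟩ := ((hcont.eventually_le_const hpos).and self_mem_nhdsWithin).exists
    exact ⟨η, (h2 : 0 < η).ne', h1⟩
  obtain ⟨N₀, hN₀⟩ := eventually_atTop.1 (hx η hη0)
  filter_upwards [eventually_ge_atTop (2 ^ N₀ + 1)] with n hn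
  have hn0 : 0 < n := (Nat.succ_pos _).trans_le hn
  set N := Nat.clog 2 n with hN
  have hnN : n ≤ 2 ^ N := Nat.le_pow_clog (by norm_num) n
  have hNN : N₀ ≤ N := by
    have h1 : 2 ^ N₀ ≤ 2 ^ N := by omega
    exact (Nat.pow_le_pow_iff_right (by norm_num)).1 h1
  have hN2 : 2 ^ N ≤ 2 * n := by
    have h1 : 1 < n := by
      have := Nat.one_le_two_pow (n := N₀)
      omega
    have h2 := Nat.pow_pred_clog_lt_self (b := 2) (by norm_num) h1
    have h3 : N ≠ 0 := by
      intro h0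
      rw [h0] at hnN
      omega
    obtain ⟨M, hM⟩ := Nat.exists_eq_succ_of_ne_zero h3
    rw [← hN, hM, Nat.pred_succ] at h2
    rw [hM, pow_succ]
    omega
  obtain ⟨G, hG, hb, hG2⟩ := hN₀ N hNN
  set S := ENNReal.ofReal √(n : ℝ) with hS
  have hS2 : S ^ 2 = n := by
    rw [hS, ← ENNReal.ofReal_pow (by positivity), Real.sq_sqrt (by positivity),
      ENNReal.ofReal_natCast]
  have hR2 : ENNReal.ofReal √(2 ^ N) ^ 2 ≤ 2 * S ^ 2 := by
    rw [hS2, ← ENNReal.ofReal_pow (by positivity), Real.sq_sqrt (by positivity),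
      ENNReal.ofReal_pow (by norm_num), ENNReal.ofReal_ofNat]
    exact_mod_cast hN2
  have hsub : pathLaw Q x {y | ε * √(n : ℝ) ≤ maxAbsPartialSum g n y} ≤
      pathLaw Q x {y | e * S ≤ ‖G y‖ₑ} := by
    refine measure_mono_ae ?_
    filter_upwards [hb] with y hy (hy2 : ε * √(n : ℝ) ≤ maxAbsPartialSum g n y)
    change e * S ≤ ‖G y‖ₑ
    have h1 : maxAbsPartialSum g n y ≤ G y := by
      refine Finset.sup'_le _ _ fun k hk => hy k ?_
      have := Finset.mem_range.1 hk
      omega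
    have h2 : 0 ≤ G y := (abs_nonneg _).trans (hy 0 (Nat.zero_le _))
    rw [Real.enorm_eq_ofReal h2, he, hS, ← ENNReal.ofReal_mul hε.le]
    exact ENNReal.ofReal_le_ofReal (hy2.trans h1)
  have hcheb : (e * S) ^ 2 * pathLaw Q x {y | e * S ≤ ‖G y‖ₑ} ≤
      eLpNorm G 2 (pathLaw Q x) ^ 2 := by
    have := mul_meas_ge_le_pow_eLpNorm' (pathLaw Q x) two_ne_zero (by norm_num) hG (e * S)
    simpa using this
  have hS0 : S ^ 2 ≠ 0 := by
    rw [hS2]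
    exact_mod_cast hn0.ne'
  have hStop : S ^ 2 ≠ ∞ := by
    rw [hS2]
    exact ENNReal.natCast_ne_top n
  refine hsub.trans ((ENNReal.mul_le_mul_iff_right (a := e ^ 2 * S ^ 2)
    (mul_ne_zero (pow_ne_zero 2 he0) hS0) (by finiteness)).1 ?_)
  calc e ^ 2 * S ^ 2 * pathLaw Q x {y | e * S ≤ ‖G y‖ₑ}
      ≤ eLpNorm G 2 (pathLaw Q x) ^ 2 := by rwa [← mul_pow]
    _ ≤ (ENNReal.ofReal √(2 ^ N) * η) ^ 2 := by gcongr
    _ ≤ (2 * S ^ 2) * η ^ 2 := by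
        rw [mul_pow]
        gcongr
    _ = S ^ 2 * (2 * η ^ 2) := by ring
    _ ≤ S ^ 2 * (δ * e ^ 2) := by gcongr
    _ = e ^ 2 * S ^ 2 * δ := by ring

/-- The law of the forward path is the π-mixture of the P^x, and the probabilities are bounded by 1,
so dominated convergence applies. -/
theorem tendsto_measure_forward (hX : IsStationaryErgodicMarkovChain P X Q) {A : ℕ → Set (ℕ → 𝓧)}
    (hA : ∀ n, MeasurableSet (A n))
    (hlim : ∀ᵐ x ∂(P.map (X 0)), Tendsto (fun n => pathLaw Q x (A n)) atTop (𝓝 0)) :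
    Tendsto (fun n => P (forward X ⁻¹' A n)) atTop (𝓝 0) := by
  have : IsProbabilityMeasure (P.map (X 0)) :=
    Measure.isProbabilityMeasure_map (hX.measurable 0).aemeasurable
  have hpath : Measurable (forward X) := measurable_pi_lambda _ fun k => hX.measurable k
  have h1 : ∀ n, P (forward X ⁻¹' A n) = ∫⁻ x, pathLaw Q x (A n) ∂(P.map (X 0)) := fun n => by
    have hm : P.map (forward X) = pathKernel Q ∘ₘ (P.map (X 0)) := hX.isMarkovChain.map_path
    rw [← Measure.map_apply hpath (hA n), hm,
      Measure.bind_apply (hA n) (Kernel.aemeasurable _)]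
    rfl
  simp_rw [h1]
  rw [← lintegral_zero (μ := P.map (X 0))]
  refine tendsto_lintegral_of_dominated_convergence (fun _ => 1)
    (fun n => (pathKernel Q).measurable_coe (hA n)) (fun n => ae_of_all _ fun x => prob_le_one)
    (by simp) hlim

end IsStationaryErgodicMarkovChain

end Conclusion

end StationarySums

end

theorem corollary4 {Ω 𝓧 : Type*} [MeasurableSpace Ω] [MeasurableSpace 𝓧]
    (P : Measure Ω) [IsProbabilityMeasure P]
    (X : ℤ → Ω → 𝓧) (Q : Kernel 𝓧 𝓧) [IsMarkovKernel Q]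
    (hX : StationarySums.IsStationaryErgodicMarkovChain P X Q)
    (g : 𝓧 → ℝ) (hg : Measurable g)
    (hg2 : MemLp g 2 (P.map (X 0)))
    (hg0 : ∫ x, g x ∂(P.map (X 0)) = 0)
    (hσ_top : Tendsto (fun n : ℕ => StationarySums.sumVariance P X g n) atTop atTop)
    (q : ℝ) (hq : 2 ≤ q)
    (h15 : (fun n : ℕ => StationarySums.condSumNorm P X g n)
      =o[atTop] fun n : ℕ => √(n : ℝ) * (Real.log n) ^ (-q))
    (hσ_zero : Tendsto (fun n : ℕ => StationarySums.sumVariance P X g n / n) atTop (𝓝 0)) :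
    TendstoInMeasure P
        (fun (n : ℕ) ω =>
          StationarySums.maxAbsPartialSum g n (StationarySums.forward X ω) / √(n : ℝ))
        atTop (fun _ => 0) ∧
      (5 / 2 < q →
        ∀ᵐ x ∂(P.map (X 0)), ∀ ε : ℝ, 0 < ε →
          Tendsto (fun n : ℕ => StationarySums.pathLaw Q x
              {y | ε * √(n : ℝ) ≤ StationarySums.maxAbsPartialSum g n y})
            atTop (𝓝 0)) := by
  -- The quenched limit is available from q ≥ 2 on, and convergence in probability is deduced from
  -- it by averaging over π.
  have hquenched := hX.ae_tendsto_pathLaw hg hg2 hq h15 hσ_zero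
  refine ⟨tendstoInMeasure_iff_norm.2 fun ε hε => ?_, fun _ => hquenched⟩
  have h := hX.tendsto_measure_forward
    (A := fun n : ℕ => {y | ε * √(n : ℝ) ≤ StationarySums.maxAbsPartialSum g n y})
    (fun n => measurableSet_le measurable_const
      (StationarySums.measurable_maxAbsPartialSum hg n))
    (hquenched.mono fun x hx => hx ε hε)
  refine tendsto_of_tendsto_of_tendsto_of_le_of_le' tendsto_const_nhds h
    (Eventually.of_forall fun _ => zero_le) ?_
  filter_upwards [eventually_gt_atTop 0] with n hn
  refine measure_mono fun ω hω => ?_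
  have hs : 0 < √(n : ℝ) := Real.sqrt_pos.2 (by exact_mod_cast hn)
  have hnonneg : 0 ≤ StationarySums.maxAbsPartialSum g n (StationarySums.forward X ω) :=
    (abs_nonneg _).trans (Finset.le_sup' (s := Finset.range (n + 1))
      (fun k => |StationarySums.partialSum g k (StationarySums.forward X ω)|)
      (Finset.mem_range.2 n.succ_pos))
  have hω' : ε ≤ ‖StationarySums.maxAbsPartialSum g n (StationarySums.forward X ω) / √(n : ℝ) - 0‖ :=
    hω
  rw [sub_zero, Real.norm_of_nonneg (div_nonneg hnonneg hs.le), le_div_iff₀ hs] at hω'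
  exact hω'
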